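/- **Setting.** Let $a_n>0$, $b_n\in\mathbb R$ ($n=0,1,2,\dots$), let $\sigma\in(0,1)$, $\alpha,\beta,\gamma\in\mathbb R$, $|\gamma|=1$, and assume that, as $n\to\infty$, $$a_n=n^\sigma\big(1+\alpha n^{-1}+O(n^{-2})\big),\qquad b_n=2\gamma n^\sigma\big(1+\beta n^{-1}+O(n^{-2})\big).$$ Put $\rho=\sigma/4$, $\tau=2\beta-2\alpha+\sigma$, $\Pi_0=\mathbb C\setminus[0,\infty)$ and, for $n\ge 1$, $$t_n(z)=-\tau n^{-1}+zn^{-\sigma},\qquad T_n(z)=t_n(z)+\sum_{l=2}^{L}p_l\,t_n(z)^l,\qquad \theta_n(z)=\sqrt{T_n(z)}.$$ Here $L$ is any positive integer with $(L+\tfrac12)\sigma>1$, and $p_2,\dots,p_L$ are the real numbers for which the polynomial $P(t)=\sum_{l=2}^Lp_lt^l$ solves the approximate eikonal equation $$\sum_{k=1}^{L}\frac{2(-1)^{k+1}}{(2k)!}\,\big(t+P(t)\big)^k=t+O(t^{L+1})\qquad(t\to0)$$ (for $L=1$, $T_n=t_n$). The root $\sqrt{\cdot}$ is the branch analytic on $\Pi_0$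 with positive imaginary part there. The closure $\operatorname{clos}\Pi_0$ is two-sided: it contains the points $\lambda+i0$ and $\lambda-i0$ on the two edges of the cut. On the cut the boundary values are used: for $\lambda>0$ with $T_n(\lambda)>0$, $\theta_n(\lambda\pm i0)=\pm\sqrt{T_n(\lambda)}$. For $N\ge1$ put $\varphi^{(N)}_n(z)=\sum_{m=N}^n\theta_m(z)$. **Theorem.** For every $z\in\gamma\operatorname{clos}\Pi_0$, $z\ne0$ (the points $\lambda\pm i0$, $\gamma\lambda>0$, included), the Jacobi equation $$a_{n-1}f_{n-1}(z)+b_nf_n(z)+a_nf_{n+1}(z)=zf_n(z),\qquad n\ge1,$$ has a solution $f_n(z)$, $n\ge 0$ (a Jost solution), with the following properties. 1. For every $n\ge0$ the function $f_n$ is analytic in $\gamma\Pi_0$ and continuous up to both edges of the cut $\gamma[0,\infty)$, with the possible exception of the point $z=0$. 2. For all $0<r<R$ there is $N_0\ge1$ such that for every $N\ge N_0$ the following holds on the set of all $z\in\gamma\operatorname{clos}\Pi_0$ with $r<|z|<R$. The phases $\theta_m(\gamma z)$, $m\ge N$, are well defined: $T_m(\gamma z)\in\Pi_0$ for $z$ off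 the cut, and $T_m(\gamma\lambda)>0$ for $z=\lambda\pm i0$. Moreover there is a function $c(z)\ne0$ on this set, analytic off the cut and continuous up to both of its edges, such that for every $z$ in this set $$f_n(z)=c(z)\,(-\gamma)^n\,n^{-\rho}\,e^{i\varphi^{(N)}_n(\gamma z)}\big(1+o(1)\big),\qquad n\to\infty.$$ Thus, for $r<|z|<R$, the Jost solution $f_n(z)/c(z)$ has exactly the asymptotics $(-\gamma)^nn^{-\rho}e^{i\varphi_n^{(N)}(\gamma z)}(1+o(1))$ and the same analyticity and continuity. -/

import Mathlib

open Filter Topology Asymptotics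

namespace JacobiJost

/-- The two sides of a cut along a real half-axis: `upper` stands for `x + i0`, `lower` for
`x - i0`. -/
inductive Side
  | upper
  | lower

/-- The sign of the imaginary part on a side. -/
def Side.sign : Side → ℝ
  | .upper => 1
  | .lower => -1

/-- The other side. -/
def Side.opp : Side → Side
  | .upper => .lower
  | .lower => .upper

/-- Points of a plane cut along a real half-axis, the cut having two edges: `off z` is the point `z`
off the cut, `edge s x` is the boundary point `x + i0` or `x - i0` of the cut. -/
inductive CutPoint
  | off (z : ℂ)
  | edge (s : Side) (x : ℝ)

/-- The underlying complex number. -/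
def CutPoint.toComplex : CutPoint → ℂ
  | .off z => z
  | .edge _ x => (x : ℂ)

/-- `Π₀ = ℂ ∖ [0, ∞)`. -/
def Pi0 : Set ℂ := {w | ¬ (w.im = 0 ∧ 0 ≤ w.re)}

/-- `γ Π₀` for `γ = ±1`. -/
def cutPlane (γ : ℝ) : Set ℂ := {z | (γ : ℂ) * z ∈ Pi0}

/-- `γ clos Π₀` without the point `0`, for `γ = ±1`; the closure contains both edges of the cut
`γ [0, ∞)`. -/
def closedCutPlane (γ : ℝ) : Set CutPoint :=
  {P | match P with
    | .off z => z ∈ cutPlane γ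
    | .edge _ x => 0 < γ * x}

open Classical in
/-- Multiplication by `γ = ±1` on two-sided points (for `γ = -1` it interchanges the sides). -/
noncomputable def CutPoint.scale (γ : ℝ) : CutPoint → CutPoint
  | .off z => .off ((γ : ℂ) * z)
  | .edge s x => .edge (if 0 < γ then s else s.opp) (γ * x)

/-- The branch of the square root that is analytic on `Π₀` and has positive imaginary part there,
with its boundary values `±√x` at `x ± i0`, `x > 0`. -/
noncomputable def CutPoint.sqrt : CutPoint → ℂ
  | .off w => Complex.I * (-w) ^ (1 / 2 : ℂ)
  | .edge s x => ((s.sign * Real.sqrt x : ℝ) : ℂ)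

open Classical in
/-- The point of the plane with cut `γ [0, ∞)` that lies over `z`; on the cut, the edge `s` is
taken. -/
noncomputable def onSide (γ : ℝ) (s : Side) (z : ℂ) : CutPoint :=
  if z ∈ cutPlane γ then .off z else .edge s z.re

/-- The closed half-plane adjacent to the side `s` of the real axis. -/
def closedHalfPlane (s : Side) : Set ℂ := {z | 0 ≤ s.sign * z.im}

/-- `g` is analytic on the part of the open set `V` (with `0 ∉ V`) off the cut `γ [0, ∞)`, and is
continuous up to either edge of the cut within `V`. -/
def AnalyticUpToCut (γ : ℝ) (V : Set ℂ) (g : CutPoint → ℂ) : Prop :=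
  DifferentiableOn ℂ (fun z => g (.off z)) (V ∩ cutPlane γ) ∧
    ∀ s : Side, ContinuousOn (fun z => g (onSide γ s z)) (V ∩ closedHalfPlane s)

/-- The open annulus `r < |z| < R`. -/
def annulus (r R : ℝ) : Set ℂ := {z | r < ‖z‖ ∧ ‖z‖ < R}

/-- `F` solves the Jacobi equation `a_{n-1} F_{n-1} + b_n F_n + a_n F_{n+1} = z F_n`, `n ≥ 1`. -/
def IsJacobiSolution (a b : ℕ → ℝ) (z : ℂ) (F : ℕ → ℂ) : Prop :=
  ∀ n : ℕ, 1 ≤ n →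
    (a (n - 1) : ℂ) * F (n - 1) + (b n : ℂ) * F n + (a n : ℂ) * F (n + 1) = z * F n

/-- The polynomial `P_L(X) = ∑_{l=2}^L p_l X^l`. -/
noncomputable def correction (L : ℕ) (p : ℕ → ℝ) : Polynomial ℝ :=
  ∑ l ∈ Finset.Icc 2 L, Polynomial.C (p l) * Polynomial.X ^ l

/-- The coefficient `2 (-1)^(k+1) / (2k)!` of `x^(2k)` in `2 (1 - cos x)`. -/
noncomputable def eikonalCoeff (k : ℕ) : ℝ := 2 * (-1) ^ (k + 1) / ((2 * k).factorial : ℝ)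

/-- The numbers `p_2, …, p_L` solve the approximate eikonal equation: with
`e_k = 2 (-1)^(k+1) / (2k)!`, the polynomial `P_L(X) + ∑_{k=2}^L e_k (P_L(X) + X)^k` has no terms
of degree at most `L`. As `e_1 = 1`, this says `∑_{k=1}^L e_k (X + P_L(X))^k = X + O(X^{L+1})`. -/
def IsEikonal (L : ℕ) (p : ℕ → ℝ) : Prop :=
  (Polynomial.X : Polynomial ℝ) ^ (L + 1) ∣
    correction L p +
      ∑ k ∈ Finset.Icc 2 L,
        Polynomial.C (eikonalCoeff k) * (correction L p + Polynomial.X) ^ k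

/-- `t_n(z) = -τ n^{-1} + z n^{-σ}`. -/
noncomputable def tSeq (σ τ : ℝ) (n : ℕ) (z : ℂ) : ℂ :=
  ((-τ * (n : ℝ)⁻¹ : ℝ) : ℂ) + z * (((n : ℝ) ^ (-σ) : ℝ) : ℂ)

/-- `T_n(z) = t_n(z) + ∑_{l=2}^L p_l t_n(z)^l`. -/
noncomputable def TSeq (σ τ : ℝ) (L : ℕ) (p : ℕ → ℝ) (n : ℕ) (z : ℂ) : ℂ :=
  tSeq σ τ n z + ∑ l ∈ Finset.Icc 2 L, (p l : ℂ) * tSeq σ τ n z ^ l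

/-- `T_n` on two-sided points. `T_n` is real on the real axis, and its value at `x ± i0` is
`T_n(x) ± i0`: for the `n` and `x` that matter, `T_n` is increasing at `x`. -/
noncomputable def TPoint (σ τ : ℝ) (L : ℕ) (p : ℕ → ℝ) (n : ℕ) : CutPoint → CutPoint
  | .off z => .off (TSeq σ τ L p n z)
  | .edge s x => .edge s (TSeq σ τ L p n (x : ℂ)).re

/-- `θ_n = √T_n`. -/
noncomputable def theta (σ τ : ℝ) (L : ℕ) (p : ℕ → ℝ) (n : ℕ) (P : CutPoint) : ℂ :=
  (TPoint σ τ L p n P).sqrt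

/-- `φ_n = ∑_{m=N}^n θ_m`, the sum of the phases from `N` on. -/
noncomputable def phi (σ τ : ℝ) (L : ℕ) (p : ℕ → ℝ) (N n : ℕ) (P : CutPoint) : ℂ :=
  ∑ m ∈ Finset.Icc N n, theta σ τ L p m P

/-- `(-γ)^n n^{-σ/4} exp(i φ_n(γ z))`, with the sum of the phases taken from `N` on. -/
noncomputable def ansatz (γ σ τ : ℝ) (L : ℕ) (p : ℕ → ℝ) (N n : ℕ) (P : CutPoint) : ℂ :=
  ((-γ : ℝ) : ℂ) ^ n * (((n : ℝ) ^ (-(σ / 4)) : ℝ) : ℂ) *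
    Complex.exp (Complex.I * phi σ τ L p N n (P.scale γ))

end JacobiJost

/-!
The equation is reduced to `a (n - 1) * u (n - 1) + a n * u (n + 1) = (γ b n - k²) * u n` by
`f_n = (-γ) ^ n u_n`, where `k = √(γ z)` is the branch of the statement. The root `k` maps the
cut plane with both edges, without `0`, onto the closed upper half-plane without `0`, so that
analyticity off the cut and continuity up to both edges become analyticity for `Im k > 0` and
continuity for `Im k ≥ 0` (`AnalyticUpToCut.comp_sqrt`).

The phases `θ_n` are defined only for large `n`, depending on the annulus, whereas the solution has
to be one function on the whole cut plane. They are therefore replaced by the global phases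
`Θ_n(k) = k n ^ (-σ/2) q(s_n(k²))`, where `T_n(w) = w n ^ (-σ) (1 + s_n(w))` and `q` is a Taylor
polynomial of `√(1 + X)`, long enough that `Θ_n - θ_n = O(n ^ (-2))` locally uniformly. As
`T_n` preserves the sign of the imaginary part for large `n`, the two-sided root `θ_n` is
`k n ^ (-σ/2) √(1 + s_n)` with the principal root (`eventually_theta_eq`); the sums of `Θ_n` and
of `θ_n` then differ by a convergent series, whose exponential is the factor `c`.

By the eikonal equation and the choice of `τ` and of the exponent `-σ/4`, the ansatz
`A_n = n ^ (-σ/4) exp(i ∑_{m ≤ n} Θ_m)` satisfies the equation up to a relative error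
`O(n ^ (-1 - σ/2 - ε))` (`unifBigO_defect`). The ratio `y = u / A` solves a discrete Volterra
equation. Its kernel contains the sums of `1 / (a_j A_j A_{j+1}) = v_j (E_{j+1} - E_j)` with
`E_j = exp(-2 i ∑_{m ≤ j} Θ_m)`, and summation by parts bounds them, since `v` has bounded
variation and `|E_j|` is essentially nondecreasing for `Im k ≥ 0` (`exists_volterraBounds`). The
kernel is then dominated by a summable sequence.

Instead of solving the infinite Volterra equation, one takes the exact solution that agrees with
the ansatz at `M` and `M + 1`. The Volterra bounds show that it converges uniformly on annuli as
`M → ∞` (`hasJostLimit`). The limit is the Jost solution, and it inherits analyticity, continuity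
and the asymptotics.
-/

namespace JacobiJost

/-! ### Uniform asymptotic calculus -/

/-- `g n k = O(n ^ e)` as `n → ∞`, uniformly for `k ∈ S`. -/
def UnifBigO (S : Set ℂ) (e : ℝ) (g : ℕ → ℂ → ℂ) : Prop :=
  (fun x : ℕ × ℂ => g x.1 x.2) =O[atTop ×ˢ 𝓟 S] fun x => (x.1 : ℝ) ^ e

section UnifBigO

variable {S : Set ℂ} {e e₁ e₂ : ℝ} {f g : ℕ → ℂ → ℂ}

theorem eventually_prod_of_nat {p : ℕ → Prop} (h : ∀ᶠ n in atTop, p n) :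
    ∀ᶠ x : ℕ × ℂ in atTop ×ˢ 𝓟 S, p x.1 :=
  tendsto_fst.eventually h

theorem unifBigO_iff : UnifBigO S e g ↔
    ∃ C : ℝ, 0 ≤ C ∧ ∀ᶠ n : ℕ in atTop, ∀ k ∈ S, ‖g n k‖ ≤ C * (n : ℝ) ^ e := by
  unfold UnifBigO
  rw [isBigO_iff']
  constructor
  · rintro ⟨C, hC, h⟩
    refine ⟨C, hC.le, ?_⟩
    rw [eventually_prod_principal_iff] at h
    filter_upwards [h] with n hn k hk
    have := hn k hk
    rwa [Real.norm_of_nonneg (by positivity)] at this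
  · rintro ⟨C, hC, h⟩
    refine ⟨C + 1, by positivity, ?_⟩
    rw [eventually_prod_principal_iff]
    filter_upwards [h] with n hn k hk
    rw [Real.norm_of_nonneg (by positivity)]
    refine (hn k hk).trans ?_
    gcongr
    linarith

theorem UnifBigO.mono (h : UnifBigO S e₁ g) (he : e₁ ≤ e₂) : UnifBigO S e₂ g := by
  refine IsBigO.trans h (IsBigO.of_bound 1 ?_)
  filter_upwards [eventually_prod_of_nat (eventually_ge_atTop 1)] with x hx
  have : (1 : ℝ) ≤ x.1 := by exact_mod_cast hx
  rw [Real.norm_of_nonneg (by positivity), Real.norm_of_nonneg (by positivity), one_mul]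
  exact Real.rpow_le_rpow_of_exponent_le this he

theorem UnifBigO.congr' (h : UnifBigO S e f)
    (hfg : ∀ᶠ n : ℕ in atTop, ∀ k ∈ S, f n k = g n k) : UnifBigO S e g := by
  refine IsBigO.congr' h ?_ EventuallyEq.rfl
  unfold EventuallyEq
  rw [eventually_prod_principal_iff]
  exact hfg

theorem UnifBigO.add (hf : UnifBigO S e f) (hg : UnifBigO S e g) :
    UnifBigO S e (fun n k => f n k + g n k) := IsBigO.add hf hg

theorem UnifBigO.sub (hf : UnifBigO S e f) (hg : UnifBigO S e g) :
    UnifBigO S e (fun n k => f n k - g n k) := IsBigO.sub hf hg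

theorem UnifBigO.neg (hf : UnifBigO S e f) : UnifBigO S e (fun n k => -f n k) :=
  IsBigO.neg_left hf

theorem UnifBigO.mul (hf : UnifBigO S e₁ f) (hg : UnifBigO S e₂ g) (he : e₁ + e₂ ≤ e) :
    UnifBigO S e (fun n k => f n k * g n k) := by
  refine UnifBigO.mono (e₁ := e₁ + e₂) ?_ he
  refine (IsBigO.mul hf hg).trans_eventuallyEq ?_
  filter_upwards [eventually_prod_of_nat (eventually_ge_atTop 1)] with x hx
  rw [Real.rpow_add (by exact_mod_cast hx)]

theorem UnifBigO.sum {ι : Type*} {s : Finset ι} {F : ι → ℕ → ℂ → ℂ}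
    (h : ∀ i ∈ s, UnifBigO S e (F i)) : UnifBigO S e (fun n k => ∑ i ∈ s, F i n k) :=
  IsBigO.fun_sum h

theorem UnifBigO.of_bounded {c : ℂ → ℂ} {C : ℝ} (h : ∀ k ∈ S, ‖c k‖ ≤ C) :
    UnifBigO S 0 (fun _ k => c k) := by
  rw [unifBigO_iff]
  refine ⟨max C 0, le_max_right _ _, Eventually.of_forall fun n k hk => ?_⟩
  simpa using Or.inl (h k hk)

theorem UnifBigO.const (c : ℂ) : UnifBigO S 0 (fun _ _ => c) :=
  UnifBigO.of_bounded (C := ‖c‖) fun _ _ => le_rfl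

theorem UnifBigO.const_mul (c : ℂ) (h : UnifBigO S e f) :
    UnifBigO S e (fun n k => c * f n k) := IsBigO.const_mul_left h c

theorem UnifBigO.of_real {u : ℕ → ℝ} (h : u =O[atTop] fun n : ℕ => (n : ℝ) ^ e) :
    UnifBigO S e (fun n _ => (u n : ℂ)) := by
  have : (fun n : ℕ => (u n : ℂ)) =O[atTop] fun n : ℕ => (n : ℝ) ^ e := by
    refine IsBigO.congr_left (IsBigO.of_norm_left (f' := fun n => (u n : ℂ)) ?_) fun _ => rfl
    simpa using h.norm_left
  exact this.comp_tendsto (tendsto_fst (f := atTop) (g := 𝓟 S))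

theorem UnifBigO.rpow (e : ℝ) : UnifBigO S e (fun n _ => (((n : ℝ) ^ e : ℝ) : ℂ)) :=
  UnifBigO.of_real (isBigO_refl _ _)

theorem UnifBigO.pow (hf : UnifBigO S e₁ f) (l : ℕ) (he : l * e₁ ≤ e) :
    UnifBigO S e (fun n k => f n k ^ l) := by
  induction l generalizing e with
  | zero => simpa using (UnifBigO.const 1).mono (by simpa using he)
  | succ l ih =>
    simp only [pow_succ]
    exact (ih le_rfl).mul hf (by push_cast at he; linarith)

theorem isBigO_rpow_succ (e : ℝ) :
    (fun n : ℕ => ((n + 1 : ℕ) : ℝ) ^ e) =O[atTop] fun n : ℕ => (n : ℝ) ^ e := by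
  refine IsBigO.of_bound (2 ^ |e|) ?_
  filter_upwards [eventually_ge_atTop 1] with n hn
  have h1 : (1 : ℝ) ≤ n := by exact_mod_cast hn
  have h0 : (0 : ℝ) < n := by linarith
  rw [Real.norm_of_nonneg (by positivity), Real.norm_of_nonneg (by positivity)]
  have : ((n + 1 : ℕ) : ℝ) = (1 + (n : ℝ)⁻¹) * n := by push_cast; field_simp
  rw [this, Real.mul_rpow (by positivity) h0.le]
  gcongr
  have h2 : (n : ℝ)⁻¹ ≤ 1 := inv_le_one_of_one_le₀ h1
  calc (1 + (n : ℝ)⁻¹) ^ e ≤ (1 + (n : ℝ)⁻¹) ^ |e| :=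
        Real.rpow_le_rpow_of_exponent_le (by simp) (le_abs_self e)
    _ ≤ 2 ^ |e| := Real.rpow_le_rpow (by positivity) (by linarith) (abs_nonneg e)

theorem UnifBigO.shift (hf : UnifBigO S e f) : UnifBigO S e (fun n k => f (n + 1) k) := by
  have ht : Tendsto (fun x : ℕ × ℂ => (x.1 + 1, x.2)) (atTop ×ˢ 𝓟 S) (atTop ×ˢ 𝓟 S) :=
    ((tendsto_add_atTop_nat 1).comp tendsto_fst).prodMk tendsto_snd
  exact (IsBigO.comp_tendsto hf ht).trans
    ((isBigO_rpow_succ e).comp_tendsto (tendsto_fst (f := atTop) (g := 𝓟 S)))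

theorem UnifBigO.eventually_le (hf : UnifBigO S e f) (he : e < 0) {δ : ℝ} (hδ : 0 < δ) :
    ∀ᶠ n : ℕ in atTop, ∀ k ∈ S, ‖f n k‖ ≤ δ := by
  obtain ⟨C, hC, h⟩ := unifBigO_iff.1 hf
  have h0 : Tendsto (fun n : ℕ => C * (n : ℝ) ^ e) atTop (𝓝 0) := by
    have := (tendsto_rpow_neg_atTop (neg_pos.2 he)).comp tendsto_natCast_atTop_atTop
    simpa using this.const_mul C
  filter_upwards [h, h0.eventually (ge_mem_nhds hδ)] with n hn h1 k hk
  exact (hn k hk).trans h1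

/-- A function with `H z = O(z ^ j)` at `0` turns `O(n ^ e)`, `e < 0`, into `O(n ^ (j e))`. -/
theorem UnifBigO.comp_isBigO {H : ℂ → ℂ} {j : ℕ} (hH : H =O[𝓝 0] fun z => z ^ j)
    (hf : UnifBigO S e₁ f) (h0 : e₁ < 0) (he : j * e₁ ≤ e) :
    UnifBigO S e (fun n k => H (f n k)) := by
  refine IsBigO.trans (hH.comp_tendsto (k := fun x : ℕ × ℂ => f x.1 x.2) ?_) (hf.pow j he)
  rw [Metric.tendsto_nhds]
  intro δ hδ
  rw [eventually_prod_principal_iff]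
  filter_upwards [hf.eventually_le h0 (half_pos hδ)] with n hn k hk
  rw [dist_zero_right]
  linarith [hn k hk]

end UnifBigO

/-- The discrete analogue of a symbol of order `e`: `g n k = O(n ^ e)` and
`g (n + 1) k - g n k = O(n ^ (e - 1))`, uniformly for `k ∈ S`. -/
def UnifSymbol (S : Set ℂ) (e : ℝ) (g : ℕ → ℂ → ℂ) : Prop :=
  UnifBigO S e g ∧ UnifBigO S (e - 1) (fun n k => g (n + 1) k - g n k)

section UnifSymbol

variable {S : Set ℂ} {e e₁ e₂ : ℝ} {f g : ℕ → ℂ → ℂ}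

theorem UnifSymbol.mono (h : UnifSymbol S e₁ g) (he : e₁ ≤ e₂) : UnifSymbol S e₂ g :=
  ⟨h.1.mono he, h.2.mono (by linarith)⟩

theorem UnifSymbol.add (hf : UnifSymbol S e f) (hg : UnifSymbol S e g) :
    UnifSymbol S e (fun n k => f n k + g n k) :=
  ⟨hf.1.add hg.1, (hf.2.add hg.2).congr' (Eventually.of_forall fun n k _ => by ring)⟩

theorem UnifSymbol.mul (hf : UnifSymbol S e₁ f) (hg : UnifSymbol S e₂ g) (he : e₁ + e₂ ≤ e) :
    UnifSymbol S e (fun n k => f n k * g n k) :=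
  ⟨hf.1.mul hg.1 he, ((hf.1.shift.mul hg.2 (e := e - 1) (by linarith)).add
    (hf.2.mul hg.1 (by linarith))).congr' (Eventually.of_forall fun n k _ => by ring)⟩

theorem UnifSymbol.of_bounded {c : ℂ → ℂ} {C : ℝ} (h : ∀ k ∈ S, ‖c k‖ ≤ C) :
    UnifSymbol S 0 (fun _ k => c k) :=
  ⟨UnifBigO.of_bounded h, by
    rw [unifBigO_iff]
    exact ⟨0, le_rfl, by simp⟩⟩

theorem UnifSymbol.const (c : ℂ) : UnifSymbol S 0 (fun _ _ => c) :=
  UnifSymbol.of_bounded (C := ‖c‖) fun _ _ => le_rfl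

theorem UnifSymbol.const_mul (c : ℂ) (h : UnifSymbol S e f) :
    UnifSymbol S e (fun n k => c * f n k) :=
  (UnifSymbol.const c).mul h (by linarith)

theorem UnifSymbol.zero : UnifSymbol S e (fun _ _ => 0) := by
  constructor <;> rw [unifBigO_iff] <;> exact ⟨0, le_rfl, by simp⟩

theorem UnifSymbol.sum {ι : Type*} {s : Finset ι} {F : ι → ℕ → ℂ → ℂ}
    (h : ∀ i ∈ s, UnifSymbol S e (F i)) : UnifSymbol S e (fun n k => ∑ i ∈ s, F i n k) := by
  classical
  induction s using Finset.induction_on with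
  | empty => simpa using UnifSymbol.zero
  | insert i s hi ih =>
    simp only [Finset.sum_insert hi]
    exact (h i (by simp)).add (ih fun j hj => h j (by simp [hj]))

theorem UnifSymbol.pow (hf : UnifSymbol S e₁ f) (l : ℕ) (he : l * e₁ ≤ e) :
    UnifSymbol S e (fun n k => f n k ^ l) := by
  induction l generalizing e with
  | zero => simpa using (UnifSymbol.const 1).mono (by simpa using he)
  | succ l ih =>
    simp only [pow_succ]
    exact (ih le_rfl).mul hf (by push_cast at he; linarith)

theorem UnifSymbol.shift (hf : UnifSymbol S e f) : UnifSymbol S e (fun n k => f (n + 1) k) :=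
  ⟨hf.1.shift, hf.2.shift⟩

/-- The product of two sequences of the form `1 + ` symbol of negative order is again of this
form. -/
theorem UnifSymbol.mul_sub_one (hf : UnifSymbol S e (fun n k => f n k - 1))
    (hg : UnifSymbol S e (fun n k => g n k - 1)) (he : e ≤ 0) :
    UnifSymbol S e (fun n k => f n k * g n k - 1) := by
  have := ((hf.mul hg (e := e) (by linarith)).add hf).add hg
  convert this using 3
  ring

theorem UnifSymbol.polynomial_eval (Q : Polynomial ℂ) (hf : UnifSymbol S e f) (he : e ≤ 0) :
    UnifSymbol S 0 (fun n k => Q.eval (f n k)) := by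
  simp only [Polynomial.eval_eq_sum_range]
  refine UnifSymbol.sum fun i _ => UnifSymbol.const_mul _ ?_
  exact hf.pow i (mul_nonpos_of_nonneg_of_nonpos (by positivity) he)

/-- Composition with a function that is Lipschitz near `0`. -/
theorem UnifSymbol.comp_sub {H : ℂ → ℂ} {d : ℂ} (hH : HasStrictDerivAt H d 0)
    (hf : UnifSymbol S e f) (he : e < 0) :
    UnifSymbol S e (fun n k => H (f n k) - H 0) := by
  have hO := hH.isBigO_sub
  have ht : Tendsto (fun x : ℕ × ℂ => f x.1 x.2) (atTop ×ˢ 𝓟 S) (𝓝 0) := by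
    rw [Metric.tendsto_nhds]
    intro δ hδ
    rw [eventually_prod_principal_iff]
    filter_upwards [hf.1.eventually_le he (half_pos hδ)] with n hn k hk
    rw [dist_zero_right]
    linarith [hn k hk]
  have hs : Tendsto (fun x : ℕ × ℂ => (x.1 + 1, x.2)) (atTop ×ˢ 𝓟 S) (atTop ×ˢ 𝓟 S) :=
    ((tendsto_add_atTop_nat 1).comp tendsto_fst).prodMk tendsto_snd
  constructor
  · have := hO.comp_tendsto (ht.prodMk_nhds (tendsto_const_nhds (x := (0 : ℂ))))
    refine IsBigO.trans this ?_
    simpa [Function.comp_def] using IsBigO.norm_left hf.1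
  · have := hO.comp_tendsto ((ht.comp hs).prodMk_nhds ht)
    refine IsBigO.congr_left (this.trans hf.2) fun x => ?_
    simp

end UnifSymbol

/-! ### Expansions in powers of `1 / n` -/

/-- The first-order Taylor expansion of an analytic function. -/
theorem AnalyticAt.isBigO_sub_sub {𝕜 : Type*} [NontriviallyNormedField 𝕜] [CompleteSpace 𝕜]
    {f : 𝕜 → 𝕜} {x : 𝕜} (hf : AnalyticAt 𝕜 f x) :
    (fun h => f (x + h) - f x - deriv f x * h) =O[𝓝 0] fun h => h ^ 2 := by
  obtain ⟨p, hp⟩ := hf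
  have h := hp.isBigO_sub_partialSum_pow 2
  refine IsBigO.congr_left (h.trans (IsBigO.of_norm_right ?_)) ?_ (f₁ := _)
  · simpa using isBigO_refl _ _
  · intro y
    have h0 : p 0 (fun _ => y) = f x := hp.coeff_zero _
    have h1 : p 1 (fun _ => y) = deriv f x * y := by
      rw [hp.deriv, FormalMultilinearSeries.apply_eq_pow_smul_coeff, pow_one, smul_eq_mul, mul_comm]
      rfl
    rw [FormalMultilinearSeries.partialSum, Finset.sum_range_succ, Finset.sum_range_one, h0, h1]
    ring

/-- `u n = 1 + c / n + O(n ^ (-2))`. -/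
def FirstOrder (c : ℝ) (u : ℕ → ℝ) : Prop :=
  (fun n : ℕ => u n - 1 - c * (n : ℝ)⁻¹) =O[atTop] fun n : ℕ => (n : ℝ) ^ (-2 : ℝ)

theorem isBigO_rpow_rpow {e₁ e₂ : ℝ} (h : e₁ ≤ e₂) :
    (fun n : ℕ => (n : ℝ) ^ e₁) =O[atTop] fun n : ℕ => (n : ℝ) ^ e₂ := by
  refine IsBigO.of_bound 1 ?_
  filter_upwards [eventually_ge_atTop 1] with n hn
  have : (1 : ℝ) ≤ n := by exact_mod_cast hn
  rw [Real.norm_of_nonneg (by positivity), Real.norm_of_nonneg (by positivity), one_mul]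
  exact Real.rpow_le_rpow_of_exponent_le this h

theorem isBigO_rpow_mul {e₁ e₂ e : ℝ} {u v : ℕ → ℝ}
    (hu : u =O[atTop] fun n : ℕ => (n : ℝ) ^ e₁) (hv : v =O[atTop] fun n : ℕ => (n : ℝ) ^ e₂)
    (he : e₁ + e₂ ≤ e) : (fun n => u n * v n) =O[atTop] fun n : ℕ => (n : ℝ) ^ e := by
  refine IsBigO.trans ((hu.mul hv).trans_eventuallyEq ?_) (isBigO_rpow_rpow he)
  filter_upwards [eventually_ge_atTop 1] with n hn
  rw [Real.rpow_add (by exact_mod_cast hn)]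

theorem isBigO_const_mul_inv (c : ℝ) :
    (fun n : ℕ => c * (n : ℝ)⁻¹) =O[atTop] fun n : ℕ => (n : ℝ) ^ (-1 : ℝ) := by
  simp only [Real.rpow_neg_one]
  exact (isBigO_refl _ _).const_mul_left c

theorem FirstOrder.sub_one {c : ℝ} {u : ℕ → ℝ} (hu : FirstOrder c u) :
    (fun n => u n - 1) =O[atTop] fun n : ℕ => (n : ℝ) ^ (-1 : ℝ) := by
  refine ((IsBigO.trans hu (isBigO_rpow_rpow (by norm_num))).add
    (isBigO_const_mul_inv c)).congr_left fun n => ?_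
  ring

theorem FirstOrder.mul {c d : ℝ} {u v : ℕ → ℝ} (hu : FirstOrder c u) (hv : FirstOrder d v) :
    FirstOrder (c + d) (fun n => u n * v n) := by
  refine (((isBigO_rpow_mul hu.sub_one hv.sub_one (e := -2) (by norm_num)).add hu).add
    hv).congr_left fun n => ?_
  ring

theorem FirstOrder.congr' {c : ℝ} {u v : ℕ → ℝ} (hu : FirstOrder c u)
    (h : ∀ᶠ n in atTop, u n = v n) : FirstOrder c v := by
  refine IsBigO.congr' hu ?_ EventuallyEq.rfl
  filter_upwards [h] with n hn
  rw [hn]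

theorem tendsto_inv_natCast : Tendsto (fun n : ℕ => (n : ℝ)⁻¹) atTop (𝓝 0) :=
  tendsto_inv_atTop_zero.comp tendsto_natCast_atTop_atTop

theorem firstOrder_rpow (d p : ℝ) :
    FirstOrder (p * d) (fun n : ℕ => (1 + d * (n : ℝ)⁻¹) ^ p) := by
  have han : AnalyticAt ℝ (fun x : ℝ => x ^ p) 1 :=
    (Real.contDiffAt_rpow_const_of_ne one_ne_zero).analyticAt
  have ht : Tendsto (fun n : ℕ => d * (n : ℝ)⁻¹) atTop (𝓝 0) := by
    simpa using tendsto_inv_natCast.const_mul d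
  have hd : deriv (fun x : ℝ => x ^ p) 1 = p := by
    simp
  have h := (AnalyticAt.isBigO_sub_sub han).comp_tendsto ht
  have h2 : (fun n : ℕ => (d * (n : ℝ)⁻¹) ^ 2) =O[atTop] fun n : ℕ => (n : ℝ) ^ (-2 : ℝ) := by
    simp only [pow_two]
    exact isBigO_rpow_mul (isBigO_const_mul_inv d) (isBigO_const_mul_inv d) (by norm_num)
  refine IsBigO.congr_left (h.trans h2) fun n => ?_
  simp only [Function.comp_apply, hd, Real.one_rpow]
  ring

theorem FirstOrder.pred {c : ℝ} {u : ℕ → ℝ} (hu : FirstOrder c u) :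
    FirstOrder c (fun n => u (n - 1)) := by
  have h1 := IsBigO.comp_tendsto hu (tendsto_sub_atTop_nat 1)
  have h2 := (firstOrder_rpow (-1) (-1)).sub_one
  have h3 := isBigO_rpow_mul h2 (isBigO_const_mul_inv c) (e := -2) (by norm_num)
  have h4 : (fun n : ℕ => ((n - 1 : ℕ) : ℝ) ^ (-2 : ℝ)) =O[atTop]
      fun n : ℕ => (n : ℝ) ^ (-2 : ℝ) := by
    refine IsBigO.of_bound 4 ?_
    filter_upwards [eventually_ge_atTop 2] with n hn
    obtain ⟨m, rfl⟩ : ∃ m, n = m + 1 := ⟨n - 1, by omega⟩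
    have hm : (1 : ℝ) ≤ m := by exact_mod_cast (by omega : 1 ≤ m)
    have e2 : (-2 : ℝ) = ((-2 : ℤ) : ℝ) := by norm_num
    rw [Real.norm_of_nonneg (by positivity), Real.norm_of_nonneg (by positivity), e2,
      Real.rpow_intCast, Real.rpow_intCast]
    simp only [Nat.add_sub_cancel, zpow_neg, zpow_ofNat]
    push_cast
    rw [← div_eq_mul_inv, inv_eq_one_div, div_le_div_iff₀ (by positivity) (by positivity)]
    nlinarith
  refine ((h1.trans h4).add h3).congr' ?_ EventuallyEq.rfl
  filter_upwards [eventually_ge_atTop 2] with n hn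
  obtain ⟨m, rfl⟩ : ∃ m, n = m + 1 := ⟨n - 1, by omega⟩
  have h0 : (m : ℝ) ≠ 0 := by exact_mod_cast (by omega : m ≠ 0)
  have h0' : (m : ℝ) + 1 ≠ 0 := by positivity
  have h5 : (1 + -1 * ((m + 1 : ℕ) : ℝ)⁻¹) = m / (m + 1) := by push_cast; field_simp; ring
  simp only [Function.comp_apply, Real.rpow_neg_one, h5]
  rw [Nat.add_sub_cancel]
  push_cast
  field_simp
  ring

theorem FirstOrder.unifSymbol {c : ℝ} {u : ℕ → ℝ} (hu : FirstOrder c u) (S : Set ℂ) :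
    UnifSymbol S (-1) (fun n _ => (u n : ℂ) - 1) := by
  constructor
  · exact (UnifBigO.of_real hu.sub_one).congr' (Eventually.of_forall fun n k _ => by simp)
  · have h2 := (firstOrder_rpow 1 (-1)).sub_one
    have h3 := isBigO_rpow_mul h2 (isBigO_const_mul_inv c) (e := -2) (by norm_num)
    have h1 := (IsBigO.comp_tendsto hu (tendsto_add_atTop_nat 1)).trans (isBigO_rpow_succ (-2))
    have h4 := (h1.sub hu).add h3
    have h5 : (fun n => u (n + 1) - u n) =O[atTop] fun n : ℕ => (n : ℝ) ^ (-2 : ℝ) := by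
      refine h4.congr' ?_ EventuallyEq.rfl
      filter_upwards [eventually_ge_atTop 1] with n hn
      have h0 : (n : ℝ) ≠ 0 := by positivity
      have h0' : (n : ℝ) + 1 ≠ 0 := by positivity
      simp only [Function.comp_apply, Real.rpow_neg_one]
      push_cast
      field_simp
      ring
    refine ((UnifBigO.of_real (S := S) h5).mono (by norm_num)).congr'
      (Eventually.of_forall fun n k _ => by push_cast; ring)

theorem unifSymbol_rpow (S : Set ℂ) (e : ℝ) :
    UnifSymbol S e (fun n _ => (((n : ℝ) ^ e : ℝ) : ℂ)) := by
  refine ⟨UnifBigO.rpow e, ?_⟩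
  have h := isBigO_rpow_mul (isBigO_refl (fun n : ℕ => (n : ℝ) ^ e) atTop)
    (firstOrder_rpow 1 e).sub_one (e := e - 1) (by linarith)
  refine (UnifBigO.of_real (S := S) h).congr' ?_
  filter_upwards [eventually_ge_atTop 1] with n hn k _
  have h0 : (0 : ℝ) < n := by exact_mod_cast hn
  rw [mul_sub, ← Real.mul_rpow h0.le (by positivity)]
  have : (n : ℝ) * (1 + 1 * (n : ℝ)⁻¹) = ((n + 1 : ℕ) : ℝ) := by push_cast; field_simp
  rw [this]
  push_cast
  ring

/-! ### The discrete Volterra equation -/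

section

/-- Summation by parts. -/
theorem sum_mul_sub_eq (v E : ℕ → ℂ) {n m : ℕ} (h : n ≤ m) :
    ∑ j ∈ Finset.Ico n m, v j * (E (j + 1) - E j) =
      v m * E m - v n * E n - ∑ j ∈ Finset.Ico n m, (v (j + 1) - v j) * E (j + 1) := by
  induction m, h using Nat.le_induction with
  | base => simp
  | succ m hm ih =>
    rw [Finset.sum_Ico_succ_top hm, Finset.sum_Ico_succ_top hm, ih]
    ring

/-- The bounds under which the equation
`W (n + 1) * (y (n + 2) - y (n + 1)) - W n * (y (n + 1) - y n) = - h (n + 1) * y (n + 1)`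
can be solved from infinity for `n ≥ N`. The functions `W n` have the form
`W n = 1 / (v n * (E (n + 1) - E n))` with `v` of bounded variation and `E` essentially
nondecreasing in modulus; `r n` dominates the tail of the summable majorant `g` from `n` on. -/
structure VolterraBounds (N : ℕ) (C : ℝ) (g r : ℕ → ℝ) (W v E h : ℕ → ℂ) : Prop where
  C_nonneg : 0 ≤ C
  g_nonneg : ∀ n, 0 ≤ g n
  sum_le : ∀ n M, ∑ j ∈ Finset.Ico n M, g j ≤ r n
  small : C * (2 + C) * r N ≤ 1 / 2
  r_le_one : r N ≤ 1
  W_ne : ∀ n, N ≤ n → W n ≠ 0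
  W_inv : ∀ n, N ≤ n → (W n)⁻¹ = v n * (E (n + 1) - E n)
  v_le : ∀ n, N ≤ n → ‖v n‖ ≤ C
  v_sub_le : ∀ n, N ≤ n → ‖v (n + 1) - v n‖ ≤ g n
  E_le : ∀ j m, N ≤ j → j ≤ m → ‖E j‖ ≤ C * ‖E m‖
  h_le : ∀ n, N ≤ n → ‖h n‖ * ‖E n‖ ≤ g n

/-- The kernel of the discrete Volterra equation. -/
noncomputable def volterraKernel (W h : ℕ → ℂ) (n m : ℕ) : ℂ :=
  (∑ j ∈ Finset.Ico n m, (W j)⁻¹) * h m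

/-- A solution of the perturbation equation that is equal to `1` at `M` and `M + 1`. -/
structure TerminalSolution (N M : ℕ) (W h y : ℕ → ℂ) : Prop where
  eq : ∀ n, N ≤ n →
    W (n + 1) * (y (n + 2) - y (n + 1)) - W n * (y (n + 1) - y n) = -(h (n + 1) * y (n + 1))
  at_end : y M = 1
  at_end_succ : y (M + 1) = 1

variable {N M M' : ℕ} {C : ℝ} {g r : ℕ → ℝ} {W v E h y y' : ℕ → ℂ}

/-- The first integral and the Volterra equation satisfied by a terminal solution; both follow by
downward induction from `M`. -/
theorem TerminalSolution.volterra (hy : TerminalSolution N M W h y)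
    (hW : ∀ n, N ≤ n → W n ≠ 0) {n : ℕ} (hN : N ≤ n) (hM : n ≤ M) :
    W n * (y (n + 1) - y n) = ∑ m ∈ Finset.Ico (n + 1) (M + 1), h m * y m ∧
      y n = 1 - ∑ m ∈ Finset.Ico (n + 1) (M + 1), volterraKernel W h n m * y m := by
  obtain ⟨d, rfl⟩ := Nat.exists_eq_add_of_le hM
  induction d generalizing n with
  | zero => simp [hy.at_end_succ, show y n = 1 from hy.at_end]
  | succ d ih =>
    have e : n + (d + 1) = n + 1 + d := by ring
    rw [e] at hy ⊢
    obtain ⟨h1, h2⟩ := ih (n := n + 1) (by omega) hy (by omega)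
    have hz : W n * (y (n + 1) - y n) =
        ∑ m ∈ Finset.Ico (n + 1) (n + 1 + d + 1), h m * y m := by
      rw [Finset.sum_eq_sum_Ico_succ_bot (by omega), ← h1]
      linear_combination -hy.eq n hN
    refine ⟨hz, ?_⟩
    have hk : ∀ m ∈ Finset.Ico (n + 1) (n + 1 + d + 1), volterraKernel W h n m * y m =
        volterraKernel W h (n + 1) m * y m + (W n)⁻¹ * (h m * y m) := by
      intro m hm
      rw [Finset.mem_Ico] at hm
      unfold volterraKernel
      rw [Finset.sum_eq_sum_Ico_succ_bot (a := n) (b := m) (by omega)]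
      ring
    have h0 : volterraKernel W h (n + 1) (n + 1) = 0 := by simp [volterraKernel]
    rw [Finset.sum_congr rfl hk, Finset.sum_add_distrib, ← Finset.mul_sum, ← hz,
      Finset.sum_eq_sum_Ico_succ_bot (by omega), h0]
    have := hW n hN
    field_simp
    linear_combination h2

/-- The growth of the sums of `1 / W j` is that of `E m`, which is compensated by `h m`. -/
theorem VolterraBounds.kernel_le (hb : VolterraBounds N C g r W v E h) {n m : ℕ} (hN : N ≤ n)
    (hm : n ≤ m) : ‖volterraKernel W h n m‖ ≤ C * (2 + C) * g m := by
  have hC := hb.C_nonneg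
  have e : ∑ j ∈ Finset.Ico n m, (W j)⁻¹ = ∑ j ∈ Finset.Ico n m, v j * (E (j + 1) - E j) :=
    Finset.sum_congr rfl fun j hj => hb.W_inv j (hN.trans (Finset.mem_Ico.1 hj).1)
  have h3 : ‖∑ j ∈ Finset.Ico n m, (v (j + 1) - v j) * E (j + 1)‖ ≤ 1 * (C * ‖E m‖) := by
    calc _ ≤ ∑ j ∈ Finset.Ico n m, g j * (C * ‖E m‖) := by
          refine norm_sum_le_of_le _ fun j hj => ?_
          rw [Finset.mem_Ico] at hj
          rw [norm_mul]
          exact mul_le_mul (hb.v_sub_le j (by omega)) (hb.E_le _ _ (by omega) (by omega))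
            (norm_nonneg _) (hb.g_nonneg j)
      _ = (∑ j ∈ Finset.Ico n m, g j) * (C * ‖E m‖) := by rw [Finset.sum_mul]
      _ ≤ 1 * (C * ‖E m‖) := by
          refine mul_le_mul_of_nonneg_right ?_ (by positivity)
          refine le_trans ?_ ((hb.sum_le N m).trans hb.r_le_one)
          exact Finset.sum_le_sum_of_subset_of_nonneg
            (Finset.Ico_subset_Ico_left hN) fun j _ _ => hb.g_nonneg j
  have h1 : ‖v m * E m‖ ≤ C * ‖E m‖ := by
    rw [norm_mul]
    exact mul_le_mul_of_nonneg_right (hb.v_le m (by omega)) (norm_nonneg _)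
  have h2 : ‖v n * E n‖ ≤ C * (C * ‖E m‖) := by
    rw [norm_mul]
    exact mul_le_mul (hb.v_le n hN) (hb.E_le _ _ hN hm) (norm_nonneg _) hC
  have h4 : ‖∑ j ∈ Finset.Ico n m, (W j)⁻¹‖ ≤ C * (2 + C) * ‖E m‖ := by
    rw [e, sum_mul_sub_eq v E hm]
    refine (norm_sub_le _ _).trans ((add_le_add (norm_sub_le _ _) le_rfl).trans ?_)
    linarith
  rw [volterraKernel, norm_mul]
  calc _ ≤ C * (2 + C) * ‖E m‖ * ‖h m‖ := by gcongr
    _ = C * (2 + C) * (‖h m‖ * ‖E m‖) := by ring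
    _ ≤ _ := by
      have := hb.h_le m (by omega)
      gcongr

theorem VolterraBounds.sum_Ico_le (hb : VolterraBounds N C g r W v E h) (n : ℕ) :
    ∑ j ∈ Finset.Ico (n + 1) (M + 1), C * (2 + C) * g j ≤ C * (2 + C) * r n := by
  have hC := hb.C_nonneg
  rw [← Finset.mul_sum]
  refine mul_le_mul_of_nonneg_left (le_trans ?_ (hb.sum_le n (M + 1))) (by positivity)
  exact Finset.sum_le_sum_of_subset_of_nonneg (Finset.Ico_subset_Ico_left (by omega))
    fun j _ _ => hb.g_nonneg j

theorem VolterraBounds.sum_Ico_le_half (hb : VolterraBounds N C g r W v E h) {n : ℕ}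
    (hn : N ≤ n) : ∑ j ∈ Finset.Ico (n + 1) (M + 1), C * (2 + C) * g j ≤ 1 / 2 := by
  have hC := hb.C_nonneg
  refine le_trans ?_ ((hb.sum_Ico_le (M := M) N).trans hb.small)
  exact Finset.sum_le_sum_of_subset_of_nonneg (Finset.Ico_subset_Ico_left (by omega))
    fun j _ _ => mul_nonneg (by positivity) (hb.g_nonneg j)

/-- A Gronwall type inequality: as the total mass of the kernel is at most `1 / 2`, comparison with
the maximum is enough. -/
theorem VolterraBounds.gronwall (hb : VolterraBounds N C g r W v E h) {x : ℕ → ℝ} {c : ℝ}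
    (hx0 : ∀ n, 0 ≤ x n)
    (hx : ∀ n, N ≤ n → n ≤ M →
      x n ≤ c + ∑ m ∈ Finset.Ico (n + 1) (M + 1), C * (2 + C) * g m * x m)
    {n : ℕ} (hn : N ≤ n) (hM : n ≤ M) : x n ≤ 2 * c := by
  have hC := hb.C_nonneg
  obtain ⟨q, hq, hmax⟩ := Finset.exists_max_image (Finset.Icc N M) x ⟨n, by simp [hn, hM]⟩
  rw [Finset.mem_Icc] at hq
  have h1 : ∑ m ∈ Finset.Ico (q + 1) (M + 1), C * (2 + C) * g m * x m ≤ 1 / 2 * x q := by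
    calc _ ≤ ∑ m ∈ Finset.Ico (q + 1) (M + 1), C * (2 + C) * g m * x q := by
          refine Finset.sum_le_sum fun m hm => ?_
          rw [Finset.mem_Ico] at hm
          refine mul_le_mul_of_nonneg_left (hmax m ?_) (mul_nonneg (by positivity) (hb.g_nonneg m))
          rw [Finset.mem_Icc]
          omega
      _ ≤ _ := by
          rw [← Finset.sum_mul]
          exact mul_le_mul_of_nonneg_right (hb.sum_Ico_le_half hq.1) (hx0 q)
  have h2 := hx q hq.1 hq.2
  have h3 := hmax n (by simp [hn, hM])
  linarith

theorem VolterraBounds.norm_le_two (hb : VolterraBounds N C g r W v E h)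
    (hy : TerminalSolution N M W h y) {n : ℕ} (hn : N ≤ n) (hM : n ≤ M) : ‖y n‖ ≤ 2 := by
  have := hb.gronwall (M := M) (x := fun n => ‖y n‖) (c := 1) (fun n => norm_nonneg _) ?_ hn hM
  · simpa using this
  intro n hn hM
  rw [(hy.volterra hb.W_ne hn hM).2]
  refine (norm_sub_le _ _).trans (add_le_add (by simp) (norm_sum_le_of_le _ fun m hm => ?_))
  rw [Finset.mem_Ico] at hm
  rw [norm_mul]
  exact mul_le_mul_of_nonneg_right (hb.kernel_le hn (by omega)) (norm_nonneg _)

theorem VolterraBounds.norm_sub_one_le (hb : VolterraBounds N C g r W v E h)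
    (hy : TerminalSolution N M W h y) {n : ℕ} (hn : N ≤ n) (hM : n ≤ M) :
    ‖y n - 1‖ ≤ 2 * (C * (2 + C)) * r n := by
  have hC := hb.C_nonneg
  have e : y n - 1 = -∑ m ∈ Finset.Ico (n + 1) (M + 1), volterraKernel W h n m * y m := by
    rw [(hy.volterra hb.W_ne hn hM).2]
    ring
  rw [e, norm_neg]
  calc _ ≤ ∑ m ∈ Finset.Ico (n + 1) (M + 1), C * (2 + C) * g m * 2 := by
        refine norm_sum_le_of_le _ fun m hm => ?_
        rw [Finset.mem_Ico] at hm
        rw [norm_mul]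
        exact mul_le_mul (hb.kernel_le hn (by omega)) (hb.norm_le_two hy (by omega) (by omega))
          (norm_nonneg _) (mul_nonneg (by positivity) (hb.g_nonneg m))
    _ ≤ _ := by
        rw [← Finset.sum_mul]
        linarith [hb.sum_Ico_le (M := M) n]

/-- Solutions normalized at `M` and at `M' ≥ M` differ by the tail of the majorant at `M`. -/
theorem VolterraBounds.norm_sub_le (hb : VolterraBounds N C g r W v E h)
    (hy : TerminalSolution N M W h y) (hy' : TerminalSolution N M' W h y') (hMM : M ≤ M')
    {n : ℕ} (hn : N ≤ n) (hM : n ≤ M) :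
    ‖y n - y' n‖ ≤ 4 * (C * (2 + C)) * r M := by
  have hC := hb.C_nonneg
  have := hb.gronwall (M := M) (x := fun n => ‖y n - y' n‖) (c := 2 * (C * (2 + C)) * r M)
    (fun n => norm_nonneg _) ?_ hn hM
  · linarith
  intro n hn hM
  have e : y n - y' n = (∑ m ∈ Finset.Ico (M + 1) (M' + 1), volterraKernel W h n m * y' m) +
      ∑ m ∈ Finset.Ico (n + 1) (M + 1), volterraKernel W h n m * -(y m - y' m) := by
    rw [(hy.volterra hb.W_ne hn hM).2, (hy'.volterra hb.W_ne hn (hM.trans hMM)).2,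
      ← Finset.sum_Ico_consecutive _ (by omega : n + 1 ≤ M + 1) (by omega : M + 1 ≤ M' + 1)]
    simp only [neg_sub, mul_sub, Finset.sum_sub_distrib]
    ring
  rw [e]
  refine (norm_add_le _ _).trans (add_le_add ?_ (norm_sum_le_of_le _ fun m hm => ?_))
  · calc _ ≤ ∑ m ∈ Finset.Ico (M + 1) (M' + 1), C * (2 + C) * g m * 2 := by
          refine norm_sum_le_of_le _ fun m hm => ?_
          rw [Finset.mem_Ico] at hm
          rw [norm_mul]
          exact mul_le_mul (hb.kernel_le hn (by omega))
            (hb.norm_le_two hy' (by omega) (by omega))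
            (norm_nonneg _) (mul_nonneg (by positivity) (hb.g_nonneg m))
      _ ≤ _ := by
          rw [← Finset.sum_mul]
          linarith [hb.sum_Ico_le (M := M') M]
  · rw [Finset.mem_Ico] at hm
    rw [norm_mul, norm_neg]
    exact mul_le_mul_of_nonneg_right (hb.kernel_le hn (by omega)) (norm_nonneg _)

end

/-! ### Taylor polynomials of the square root and of the cosine -/

section

/-- The Taylor polynomials of `√(1 + X)`. -/
theorem exists_sqrt_polynomial (K : ℕ) : ∃ q : Polynomial ℂ, q.coeff 0 = 1 ∧
    (Polynomial.X : Polynomial ℂ) ^ (K + 1) ∣ q ^ 2 - (1 + Polynomial.X) := by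
  induction K with
  | zero => exact ⟨1, by simp, ⟨-1, by ring⟩⟩
  | succ K ih =>
    obtain ⟨q, hq, g, hg⟩ := ih
    -- The correction `c X ^ (K + 1)` cancels the leading term `g(0) X ^ (K + 1)` of the error.
    obtain ⟨q₁, hq₁⟩ : ∃ q₁, q = q₁ * Polynomial.X + Polynomial.C 1 :=
      ⟨q.divX, by rw [← hq, Polynomial.divX_mul_X_add]⟩
    obtain ⟨g₁, d, hg₁⟩ : ∃ g₁ d, g = g₁ * Polynomial.X + Polynomial.C d :=
      ⟨g.divX, g.coeff 0, by rw [Polynomial.divX_mul_X_add]⟩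
    refine ⟨q + Polynomial.C (-d / 2) * Polynomial.X ^ (K + 1), ?_, ?_⟩
    · simp [hq]
    · refine ⟨g₁ + 2 * Polynomial.C (-d / 2) * q₁ +
        Polynomial.C (-d / 2) ^ 2 * Polynomial.X ^ K, ?_⟩
      have h2 : (2 : Polynomial ℂ) * Polynomial.C (-d / 2) = -Polynomial.C d := by
        rw [← Polynomial.C_ofNat 2, ← Polynomial.C_mul, ← Polynomial.C_neg]
        congr 1
        ring
      have h1 : Polynomial.C (1 : ℂ) = 1 := Polynomial.C_1
      rw [h1] at hq₁
      rw [hg₁] at hg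
      linear_combination hg + Polynomial.X ^ (K + 1) * h2 +
        2 * Polynomial.C (-d / 2) * Polynomial.X ^ (K + 1) * hq₁

theorem sum_exp_terms_eq (L : ℕ) (z : ℂ) :
    ∑ m ∈ Finset.range (2 * L + 2), (Complex.I * z) ^ m / (m.factorial : ℂ) +
      ∑ m ∈ Finset.range (2 * L + 2), (-(Complex.I * z)) ^ m / (m.factorial : ℂ) =
      2 - ∑ k ∈ Finset.Icc 1 L, (eikonalCoeff k : ℂ) * (z ^ 2) ^ k := by
  induction L with
  | zero => simp [Finset.sum_range_succ]; ring
  | succ L ih =>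
    have e : 2 * (L + 1) + 2 = 2 * L + 2 + 1 + 1 := by ring
    rw [e, Finset.sum_range_succ _ (2 * L + 2 + 1), Finset.sum_range_succ _ (2 * L + 2),
      Finset.sum_range_succ _ (2 * L + 2 + 1), Finset.sum_range_succ _ (2 * L + 2),
      Finset.sum_Icc_succ_top (by omega)]
    have h1 : (-(Complex.I * z)) ^ (2 * L + 2) = (Complex.I * z) ^ (2 * L + 2) :=
      Even.neg_pow (by exact ⟨L + 1, by ring⟩) _
    have h2 : (-(Complex.I * z)) ^ (2 * L + 2 + 1) = -(Complex.I * z) ^ (2 * L + 2 + 1) :=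
      Odd.neg_pow (by exact ⟨L + 1, by ring⟩) _
    have h3 : (Complex.I * z) ^ (2 * L + 2) = (-1) ^ (L + 1) * (z ^ 2) ^ (L + 1) := by
      rw [show 2 * L + 2 = 2 * (L + 1) by ring, pow_mul, mul_pow, Complex.I_sq, mul_pow]
    have h4 : (eikonalCoeff (L + 1) : ℂ) =
        2 * (-1) ^ (L + 1 + 1) / ((2 * L + 2).factorial : ℂ) := by
      unfold eikonalCoeff
      push_cast
      rfl
    rw [h1, h2, h3, h4]
    linear_combination ih

theorem cos_taylor_isBigO (L : ℕ) :
    (fun z : ℂ => Complex.exp (Complex.I * z) + Complex.exp (-(Complex.I * z)) - 2 +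
      ∑ k ∈ Finset.Icc 1 L, (eikonalCoeff k : ℂ) * (z ^ 2) ^ k)
      =O[𝓝 0] fun z => z ^ (2 * L + 2) := by
  have h := Complex.exp_sub_sum_range_isBigO_pow (2 * L + 2)
  have t1 : Tendsto (fun z : ℂ => Complex.I * z) (𝓝 0) (𝓝 0) := by
    simpa using (continuous_const_mul Complex.I).tendsto 0
  have t2 : Tendsto (fun z : ℂ => -(Complex.I * z)) (𝓝 0) (𝓝 0) := by simpa using t1.neg
  have h1 := (h.comp_tendsto t1).trans (IsBigO.of_bound 1
    (Eventually.of_forall fun z => by simp) : _ =O[𝓝 0] fun z : ℂ => z ^ (2 * L + 2))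
  have h2 := (h.comp_tendsto t2).trans (IsBigO.of_bound 1
    (Eventually.of_forall fun z => by simp) : _ =O[𝓝 0] fun z : ℂ => z ^ (2 * L + 2))
  refine (h1.add h2).congr_left fun z => ?_
  simp only [Function.comp_apply]
  linear_combination -sum_exp_terms_eq L z

/-- The eikonal equation as an identity of polynomial functions on `ℂ`. -/
theorem IsEikonal.exists_eval {L : ℕ} {p : ℕ → ℝ} (hp : IsEikonal L p) (hL : 1 ≤ L) :
    ∃ g : Polynomial ℂ, ∀ t : ℂ,
      ∑ k ∈ Finset.Icc 1 L, (eikonalCoeff k : ℂ) *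
        (t + ∑ l ∈ Finset.Icc 2 L, (p l : ℂ) * t ^ l) ^ k = t + t ^ (L + 1) * g.eval t := by
  obtain ⟨g, hg⟩ := hp
  refine ⟨g.map (algebraMap ℝ ℂ), fun t => ?_⟩
  have h := congrArg (Polynomial.aeval t) hg
  simp only [correction, map_add, map_sum, map_mul, map_pow, Polynomial.aeval_X,
    Polynomial.aeval_C, Complex.coe_algebraMap] at h
  have h1 : (eikonalCoeff 1 : ℂ) = 1 := by
    simp [eikonalCoeff]
  rw [Polynomial.eval_map_algebraMap, ← Finset.add_sum_Ioc_eq_sum_Icc hL, h1,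
    ← Finset.Icc_add_one_left_eq_Ioc]
  rw [← h]
  generalize ∑ l ∈ Finset.Icc 2 L, (p l : ℂ) * t ^ l = s
  rw [add_comm t s, one_add_one_eq_two]
  ring

/-! ### The global phase -/

/-- The closed annulus `r ≤ |k| ≤ R`. -/
def closedAnnulus (r R : ℝ) : Set ℂ := {k | r ≤ ‖k‖ ∧ ‖k‖ ≤ R}

/-- The relative correction `s_n(w)` in `T_n(w) = w n ^ (-σ) (1 + s_n(w))`; it is a Laurent
polynomial in `w`. -/
noncomputable def relCorrection (σ τ : ℝ) (L : ℕ) (p : ℕ → ℝ) (n : ℕ) (w : ℂ) : ℂ :=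
  -τ * (((n : ℝ) ^ (σ - 1) : ℝ) : ℂ) * w⁻¹ +
    ∑ l ∈ Finset.Icc 2 L, (p l : ℂ) * ((((n : ℝ) ^ σ : ℝ) : ℂ) * tSeq σ τ n w ^ l * w⁻¹)

/-- The global phase `k n ^ (-σ/2) q(s_n(k²))`, where `q` is a Taylor polynomial of `√(1 + X)`. It
approximates `√(T_n(k²))` and, unlike that root, is analytic for all `k ≠ 0` and all `n`. -/
noncomputable def phase (σ τ : ℝ) (L : ℕ) (p : ℕ → ℝ) (q : Polynomial ℂ) (n : ℕ) (k : ℂ) : ℂ :=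
  k * (((n : ℝ) ^ (-(σ / 2)) : ℝ) : ℂ) * q.eval (relCorrection σ τ L p n (k ^ 2))

/-- `ε` is small enough for all error terms below to be controlled by powers of `n ^ (-ε)`. -/
structure SmallExponent (σ : ℝ) (L : ℕ) (ε : ℝ) : Prop where
  pos : 0 < ε
  two_mul_le : 2 * ε ≤ σ
  le_one_sub : ε ≤ 1 - σ
  le_L : 1 + ε ≤ (L + 1 / 2) * σ

theorem exists_smallExponent {σ : ℝ} {L : ℕ} (hσ0 : 0 < σ) (hσ1 : σ < 1)
    (hL : 1 < ((L : ℝ) + 1 / 2) * σ) : ∃ ε, SmallExponent σ L ε := by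
  refine ⟨min (σ / 2) (min (1 - σ) ((L + 1 / 2) * σ - 1)), ?_, ?_, ?_, ?_⟩
  · simp only [lt_min_iff]
    exact ⟨by linarith, by linarith, by linarith⟩
  · linarith [min_le_left (σ / 2) (min (1 - σ) ((L + 1 / 2) * σ - 1))]
  · exact (min_le_right _ _).trans (min_le_left _ _)
  · have := (min_le_right (σ / 2) (min (1 - σ) ((L + 1 / 2) * σ - 1))).trans (min_le_right _ _)
    linarith

variable {σ τ : ℝ} {L : ℕ} {p : ℕ → ℝ} {q : Polynomial ℂ} {ε r R : ℝ}

theorem TSeq_eq {n : ℕ} (hn : 1 ≤ n) {w : ℂ} (hw : w ≠ 0) :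
    TSeq σ τ L p n w =
      w * (((n : ℝ) ^ (-σ) : ℝ) : ℂ) * (1 + relCorrection σ τ L p n w) := by
  have h0 : (0 : ℝ) < n := by exact_mod_cast hn
  have h1 : (n : ℝ) ^ (-σ) * (n : ℝ) ^ σ = 1 := by
    rw [← Real.rpow_add h0]; simp
  have h2 : (n : ℝ) ^ (-σ) * (n : ℝ) ^ (σ - 1) = (n : ℝ)⁻¹ := by
    rw [← Real.rpow_add h0, ← Real.rpow_neg_one]; congr 1; ring
  have h1' : (((n : ℝ) ^ (-σ) : ℝ) : ℂ) * (((n : ℝ) ^ σ : ℝ) : ℂ) = 1 := by exact_mod_cast h1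
  have h2' : (((n : ℝ) ^ (-σ) : ℝ) : ℂ) * (((n : ℝ) ^ (σ - 1) : ℝ) : ℂ) = ((n : ℝ) : ℂ)⁻¹ := by
    exact_mod_cast h2
  unfold TSeq relCorrection
  rw [mul_add, mul_add, Finset.mul_sum, mul_one, ← add_assoc]
  congr 1
  · unfold tSeq
    push_cast
    push_cast at h2'
    rw [← h2']
    field_simp
    ring
  · refine Finset.sum_congr rfl fun l _ => ?_
    field_simp
    linear_combination -(p l : ℂ) * tSeq σ τ n w ^ l * h1'

theorem sq_bounded {k : ℂ} (hk : k ∈ closedAnnulus r R) : ‖k ^ 2‖ ≤ R ^ 2 := by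
  rw [norm_pow]
  exact pow_le_pow_left₀ (norm_nonneg _) hk.2 2

theorem sq_inv_bounded (hr : 0 < r) {k : ℂ} (hk : k ∈ closedAnnulus r R) :
    ‖(k ^ 2)⁻¹‖ ≤ (r ^ 2)⁻¹ := by
  rw [norm_inv, norm_pow]
  exact inv_anti₀ (by positivity) (pow_le_pow_left₀ hr.le hk.1 2)

theorem unifSymbol_tSeq (hσ1 : σ ≤ 1) :
    UnifSymbol (closedAnnulus r R) (-σ) (fun n k => tSeq σ τ n (k ^ 2)) := by
  have h1 := (unifSymbol_rpow (closedAnnulus r R) (-1)).const_mul (-τ : ℂ)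
  have h2 := (UnifSymbol.of_bounded (S := closedAnnulus r R) (c := fun k => k ^ 2)
    fun k hk => sq_bounded hk).mul (unifSymbol_rpow _ (-σ)) (e := -σ) (by linarith)
  convert (h1.mono (e₂ := -σ) (by linarith)).add h2 using 3
  rw [Real.rpow_neg_one, tSeq]
  push_cast
  ring

theorem unifSymbol_relCorrection (hr : 0 < r) (hε : SmallExponent σ L ε) :
    UnifSymbol (closedAnnulus r R) (-ε) (fun n k => relCorrection σ τ L p n (k ^ 2)) := by
  have h2 := hε.two_mul_le
  have h3 := hε.le_one_sub
  have h0 := hε.pos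
  have hw := UnifSymbol.of_bounded (S := closedAnnulus r R) (c := fun k => (k ^ 2)⁻¹)
    fun k hk => sq_inv_bounded hr hk
  have h1 := ((unifSymbol_rpow (closedAnnulus r R) (σ - 1)).const_mul (-τ : ℂ)).mul hw
    (e := -ε) (by linarith)
  refine h1.add (UnifSymbol.sum fun l hl => UnifSymbol.const_mul _ ?_)
  rw [Finset.mem_Icc] at hl
  have hl2 : (2 : ℝ) ≤ l := by exact_mod_cast hl.1
  have ht := (unifSymbol_tSeq (σ := σ) (τ := τ) (r := r) (R := R) (by linarith)).pow l le_rfl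
  refine ((unifSymbol_rpow _ σ).mul ht le_rfl).mul hw ?_
  nlinarith

theorem unifSymbol_eval_sub_one (hq : q.coeff 0 = 1) {f : ℕ → ℂ → ℂ} {S : Set ℂ} {e : ℝ}
    (hf : UnifSymbol S e f) (he : e ≤ 0) :
    UnifSymbol S e (fun n k => q.eval (f n k) - 1) := by
  have h := (UnifSymbol.polynomial_eval q.divX hf he).mul hf (e := e) (by linarith)
  convert h using 3 with n k
  conv_lhs => rw [← Polynomial.divX_mul_X_add q, hq]
  simp

theorem unifSymbol_phase (hr : 0 < r) (hε : SmallExponent σ L ε) :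
    UnifSymbol (closedAnnulus r R) (-(σ / 2)) (phase σ τ L p q) := by
  have hk := UnifSymbol.of_bounded (S := closedAnnulus r R) (c := fun k => k) fun k hk => hk.2
  exact (hk.mul (unifSymbol_rpow _ (-(σ / 2))) le_rfl).mul
    ((unifSymbol_relCorrection hr hε).polynomial_eval q (by linarith [hε.pos])) (by linarith)

/-- The phase satisfies `Θ_{n+1} - Θ_n = -(σ/2) Θ_n / n` up to a smaller error. -/
theorem unifBigO_phase_succ (hq : q.coeff 0 = 1) (hr : 0 < r) (hε : SmallExponent σ L ε) :
    UnifBigO (closedAnnulus r R) (-(σ / 2) - 1 - ε) (fun n k =>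
      phase σ τ L p q (n + 1) k - phase σ τ L p q n k +
        (((σ / 2) * (n : ℝ)⁻¹ : ℝ) : ℂ) * phase σ τ L p q n k) := by
  have h2 := hε.two_mul_le
  have h3 := hε.le_one_sub
  have h0 := hε.pos
  have hk := UnifBigO.of_bounded (S := closedAnnulus r R) (c := fun k => k) fun k hk => hk.2
  have hs := unifSymbol_relCorrection (τ := τ) (p := p) (R := R) hr hε
  have hq1 := (unifSymbol_eval_sub_one hq hs (by linarith)).2
  have hqb := (hs.polynomial_eval q (by linarith)).1
  have hp := (UnifBigO.rpow (S := closedAnnulus r R) (-(σ / 2)))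
  have hx := UnifBigO.of_real (S := closedAnnulus r R) (firstOrder_rpow 1 (-(σ / 2)))
  have t1 := (hk.mul hp.shift le_rfl).mul hq1 (e := -(σ / 2) - 1 - ε) (by linarith)
  have t2 := (hk.mul (hp.mul hx le_rfl) le_rfl).mul hqb (e := -(σ / 2) - 1 - ε) (by linarith)
  refine (t1.add t2).congr' ?_
  filter_upwards [eventually_ge_atTop 1] with n hn k _
  have hn0 : (0 : ℝ) < n := by exact_mod_cast hn
  have e : ((n + 1 : ℕ) : ℝ) ^ (-(σ / 2)) =
      (n : ℝ) ^ (-(σ / 2)) * (1 + 1 * (n : ℝ)⁻¹) ^ (-(σ / 2)) := by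
    rw [← Real.mul_rpow hn0.le (by positivity)]
    congr 1
    push_cast
    field_simp
  unfold phase
  rw [e]
  push_cast
  ring

theorem unifBigO_phase_sq_sub (hr : 0 < r) (hε : SmallExponent σ L ε) {K : ℕ}
    (hK : 2 ≤ (K + 1) * ε)
    (hqK : (Polynomial.X : Polynomial ℂ) ^ (K + 1) ∣ q ^ 2 - (1 + Polynomial.X)) :
    UnifBigO (closedAnnulus r R) (-σ - 2) (fun n k =>
      phase σ τ L p q n k ^ 2 - TSeq σ τ L p n (k ^ 2)) := by
  obtain ⟨g, hg⟩ := hqK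
  have h0 := hε.pos
  have hs := unifSymbol_relCorrection (τ := τ) (p := p) (R := R) hr hε
  have hw := UnifBigO.of_bounded (S := closedAnnulus r R) (c := fun k => k ^ 2)
    fun k hk => sq_bounded hk
  have h1 := (hw.mul (UnifBigO.rpow (-σ)) le_rfl).mul ((hs.1.pow (K + 1) (e := -2)
    (by push_cast; linarith)).mul (hs.polynomial_eval g (by linarith)).1 (e := -2) (by linarith))
    (e := -σ - 2) (by linarith)
  refine h1.congr' ?_
  filter_upwards [eventually_ge_atTop 1] with n hn k hk
  have hk0 : k ≠ 0 := norm_pos_iff.1 (hr.trans_le hk.1)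
  have hn0 : (0 : ℝ) < n := by exact_mod_cast hn
  rw [TSeq_eq hn (pow_ne_zero 2 hk0)]
  have h := congrArg (Polynomial.eval (relCorrection σ τ L p n (k ^ 2))) hg
  simp only [Polynomial.eval_sub, Polynomial.eval_pow, Polynomial.eval_add, Polynomial.eval_one,
    Polynomial.eval_X, Polynomial.eval_mul] at h
  have e : (n : ℝ) ^ (-(σ / 2)) ^ 1 * (n : ℝ) ^ (-(σ / 2)) = (n : ℝ) ^ (-σ) := by
    rw [← Real.rpow_add hn0]; congr 1; ring
  have e' : (((n : ℝ) ^ (-(σ / 2)) : ℝ) : ℂ) * (((n : ℝ) ^ (-(σ / 2)) : ℝ) : ℂ) =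
      (((n : ℝ) ^ (-σ) : ℝ) : ℂ) := by
    rw [pow_one] at e
    exact_mod_cast e
  unfold phase
  rw [← e']
  linear_combination -(k * (((n : ℝ) ^ (-(σ / 2)) : ℝ) : ℂ)) ^ 2 * h

theorem UnifBigO.pow_sub_pow {S : Set ℂ} {e : ℝ} {f g : ℕ → ℂ → ℂ} (hf : UnifBigO S 0 f)
    (hg : UnifBigO S 0 g) (h : UnifBigO S e (fun n k => f n k - g n k)) (j : ℕ) :
    UnifBigO S e (fun n k => f n k ^ j - g n k ^ j) := by
  induction j with
  | zero =>
    rw [unifBigO_iff]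
    exact ⟨0, le_rfl, by simp⟩
  | succ j ih =>
    refine ((hf.mul ih (e := e) (by linarith)).add (h.mul (hg.pow j (e := 0) (by simp))
      (e := e) (by linarith))).congr' (Eventually.of_forall fun n k _ => ?_)
    ring

/-- The eikonal equation for the global phase: `2 cos Θ_n - 2 + t_n` is small. -/
theorem unifBigO_eikonal (hp : IsEikonal L p) (hσ1 : σ ≤ 1) (hr : 0 < r)
    (hε : SmallExponent σ L ε)
    {K : ℕ} (hK : 2 ≤ (K + 1) * ε)
    (hqK : (Polynomial.X : Polynomial ℂ) ^ (K + 1) ∣ q ^ 2 - (1 + Polynomial.X)) :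
    UnifBigO (closedAnnulus r R) (-(σ / 2) - 1 - ε) (fun n k =>
      Complex.exp (Complex.I * phase σ τ L p q n k) +
        Complex.exp (-(Complex.I * phase σ τ L p q n k)) - 2 + tSeq σ τ n (k ^ 2)) := by
  have h0 := hε.pos
  have h2 := hε.two_mul_le
  have h3 := hε.le_one_sub
  have h4 := hε.le_L
  have hL : 1 ≤ L := by
    rcases Nat.eq_zero_or_pos L with h | h
    · subst h
      norm_num at h4
      linarith
    · exact h
  obtain ⟨g, hg⟩ := hp.exists_eval hL
  have hΘ := (unifSymbol_phase (τ := τ) (p := p) (q := q) (R := R) hr hε).1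
  have ht := unifSymbol_tSeq (σ := σ) (τ := τ) (r := r) (R := R) hσ1
  have hcos := hΘ.comp_isBigO (cos_taylor_isBigO L) (e := -(σ / 2) - 1 - ε) (by linarith)
    (by push_cast; linarith)
  have hT : UnifBigO (closedAnnulus r R) 0 (fun n k => TSeq σ τ L p n (k ^ 2)) := by
    refine (ht.1.mono (by linarith)).add (UnifBigO.sum fun l _ => UnifBigO.const_mul _
      (ht.1.pow l ?_))
    exact mul_nonpos_of_nonneg_of_nonpos (by positivity) (by linarith)
  have hd : UnifBigO (closedAnnulus r R) (-(σ / 2) - 1 - ε) (fun n k =>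
      ∑ j ∈ Finset.Icc 1 L, (eikonalCoeff j : ℂ) *
        ((phase σ τ L p q n k ^ 2) ^ j - TSeq σ τ L p n (k ^ 2) ^ j)) :=
    UnifBigO.sum fun j _ => UnifBigO.const_mul _
      (((hΘ.pow 2 (e := 0) (by push_cast; linarith)).pow_sub_pow hT
        (unifBigO_phase_sq_sub hr hε hK hqK) j).mono (by linarith))
  have hrem : UnifBigO (closedAnnulus r R) (-(σ / 2) - 1 - ε) (fun n k =>
      tSeq σ τ n (k ^ 2) ^ (L + 1) * g.eval (tSeq σ τ n (k ^ 2))) :=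
    (ht.1.pow (L + 1) le_rfl).mul (ht.polynomial_eval g (by linarith)).1
      (by push_cast; linarith)
  refine ((hcos.sub hd).sub hrem).congr' (Eventually.of_forall fun n k _ => ?_)
  have := hg (tSeq σ τ n (k ^ 2))
  simp only [mul_sub, Finset.sum_sub_distrib]
  unfold TSeq
  linear_combination this

/-- The relative defect of the ansatz in the Jacobi equation is `O(n ^ (-1 - σ/2 - ε))`. The
hypotheses on `c₁`, `c₂`, `c₃` describe the relative sizes of the three coefficients of the
equation. -/
theorem unifBigO_defect (hp : IsEikonal L p) (hσ1 : σ ≤ 1) (hr : 0 < r)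
    (hε : SmallExponent σ L ε) (hq : q.coeff 0 = 1)
    {K : ℕ} (hK : 2 ≤ (K + 1) * ε)
    (hqK : (Polynomial.X : Polynomial ℂ) ^ (K + 1) ∣ q ^ 2 - (1 + Polynomial.X))
    {α β : ℝ} (hτ : τ = 2 * β - 2 * α + σ) {c₁ c₂ c₃ : ℕ → ℝ}
    (hc₁ : FirstOrder (α - 3 * σ / 4) c₁) (hc₂ : FirstOrder (α - σ / 4) c₂)
    (hc₃ : FirstOrder β c₃) :
    UnifBigO (closedAnnulus r R) (-(σ / 2) - 1 - ε) (fun n k =>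
      (c₁ n : ℂ) * Complex.exp (-(Complex.I * phase σ τ L p q n k)) +
        (c₂ n : ℂ) * Complex.exp (Complex.I * phase σ τ L p q (n + 1) k) -
        2 * (c₃ n : ℂ) + k ^ 2 * (((n : ℝ) ^ (-σ) : ℝ) : ℂ)) := by
  have h0 := hε.pos
  have h2 := hε.two_mul_le
  have h3 := hε.le_one_sub
  set S := closedAnnulus r R
  set e₀ := -(σ / 2) - 1 - ε with he₀
  have hΘs := unifSymbol_phase (τ := τ) (p := p) (q := q) (R := R) hr hε
  have hΘ := hΘs.1
  have hd := hΘs.2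
  have hD := unifBigO_phase_succ (τ := τ) (p := p) (R := R) hq hr hε
  have hcos := unifBigO_eikonal (τ := τ) (R := R) hp hσ1 hr hε hK hqK
  have hinv : ∀ c : ℝ, UnifBigO S (-1) (fun n _ => ((c * (n : ℝ)⁻¹ : ℝ) : ℂ)) := fun c =>
    UnifBigO.of_real (isBigO_const_mul_inv c)
  have hI1 : UnifBigO S (-(σ / 2)) (fun n k => Complex.I * phase σ τ L p q n k) :=
    hΘ.const_mul _
  have hI2 : UnifBigO S (-(σ / 2)) (fun n k => -(Complex.I * phase σ τ L p q n k)) := hI1.neg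
  have E1 : (fun z : ℂ => Complex.exp z) =O[𝓝 0] fun z => z ^ 0 := by
    simpa using Complex.exp_sub_sum_range_isBigO_pow 0
  have E2 : (fun z : ℂ => Complex.exp z - 1) =O[𝓝 0] fun z => z ^ 1 := by
    simpa using Complex.exp_sub_sum_range_isBigO_pow 1
  have E3 : (fun z : ℂ => Complex.exp z - (1 + z)) =O[𝓝 0] fun z => z ^ 2 := by
    simpa [Finset.sum_range_succ] using Complex.exp_sub_sum_range_isBigO_pow 2
  have neg : -(σ / 2) < 0 := by linarith
  have hb1 := hI1.comp_isBigO E1 neg (e := 0) (by simp)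
  have hb2 := hI2.comp_isBigO E1 neg (e := 0) (by simp)
  have hl1 := hI1.comp_isBigO E2 neg (e := -(σ / 2)) (by simp)
  have hs1 := hI1.comp_isBigO E3 neg (e := -σ) (by push_cast; linarith)
  have hs2 := hI2.comp_isBigO E3 neg (e := -σ) (by push_cast; linarith)
  have hdd := (hd.const_mul Complex.I).comp_isBigO E3 (by linarith) (e := e₀)
    (by push_cast; linarith)
  have herr : UnifBigO S e₀ (fun n k => Complex.exp (Complex.I * phase σ τ L p q n k) *
      ((Complex.exp (Complex.I * (phase σ τ L p q (n + 1) k - phase σ τ L p q n k)) -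
        (1 + Complex.I * (phase σ τ L p q (n + 1) k - phase σ τ L p q n k))) +
        Complex.I * (phase σ τ L p q (n + 1) k - phase σ τ L p q n k +
          (((σ / 2) * (n : ℝ)⁻¹ : ℝ) : ℂ) * phase σ τ L p q n k))) :=
    hb1.mul (hdd.add (hD.const_mul _)) (by linarith)
  have hC2 : UnifBigO S 0 (fun n _ => (c₂ n : ℂ)) :=
    (((hc₂.unifSymbol S).1.mono (e₂ := 0) (by norm_num)).add (UnifBigO.const 1)).congr'
      (Eventually.of_forall fun n k _ => by ring)
  have r1 := UnifBigO.of_real (S := S) hc₁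
  have r2 := UnifBigO.of_real (S := S) hc₂
  have r3 := UnifBigO.of_real (S := S) hc₃
  have t1 := (hinv (α - 3 * σ / 4)).mul hs2 (e := e₀) (by linarith)
  have t2 := (hinv (α - σ / 4)).mul hs1 (e := e₀) (by linarith)
  have t3 := ((hinv (σ / 2)).mul hI1 le_rfl).mul hl1 (e := e₀) (by linarith)
  have t4 := hC2.mul herr (e := e₀) (by linarith)
  have t5 := r1.mul hb2 (e := e₀) (by linarith)
  have hfac : UnifBigO S 0 (fun n k =>
      1 - (((σ / 2) * (n : ℝ)⁻¹ : ℝ) : ℂ) * (Complex.I * phase σ τ L p q n k)) :=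
    (UnifBigO.const 1).sub ((hinv (σ / 2)).mul hI1 (by linarith))
  have t6 := r2.mul (hb1.mul hfac le_rfl) (e := e₀) (by linarith)
  have t7 := ((hinv (α - σ / 4)).mul hb1 le_rfl).mul ((hinv (σ / 2)).mul hI1 le_rfl) (e := e₀)
    (by linarith)
  have t8 := (r3.const_mul 2).mono (e₂ := e₀) (by linarith)
  refine ((((((((hcos.add t1).add t2).sub t3).add t4).add t5).add t6).sub t7).sub t8).congr'
    (Eventually.of_forall fun n k _ => ?_)
  have hexp : Complex.exp (Complex.I * phase σ τ L p q (n + 1) k) =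
      Complex.exp (Complex.I * phase σ τ L p q n k) *
        Complex.exp (Complex.I * (phase σ τ L p q (n + 1) k - phase σ τ L p q n k)) := by
    rw [← Complex.exp_add]
    congr 1
    ring
  -- The terms of order `Θ_n / n` cancel because of the exponent `-σ/4` in `c₁`, `c₂`, those of order
  -- `1 / n` because of the choice of `τ`.
  rw [hexp, tSeq, hτ]
  push_cast
  ring

end

/-! ### The square root as a uniformization of the cut plane -/

theorem sq_cpow_half (z : ℂ) : (z ^ (1 / 2 : ℂ)) ^ 2 = z := by
  rw [one_div]
  exact Complex.cpow_nat_inv_pow z two_ne_zero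

theorem cpow_half_eq {z : ℂ} (hz : z ≠ 0) :
    (z ^ (1 / 2 : ℂ)).re = Real.exp (Real.log ‖z‖ / 2) * Real.cos (z.arg / 2) ∧
      (z ^ (1 / 2 : ℂ)).im = Real.exp (Real.log ‖z‖ / 2) * Real.sin (z.arg / 2) := by
  have e : Complex.log z * (1 / 2 : ℂ) = ((Real.log ‖z‖ / 2 : ℝ) : ℂ) +
      ((z.arg / 2 : ℝ) : ℂ) * Complex.I := by
    rw [Complex.log]
    push_cast
    ring
  rw [Complex.cpow_def_of_ne_zero hz, e]
  simp [Complex.exp_re, Complex.exp_im]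

theorem cpow_half_re_nonneg (z : ℂ) : 0 ≤ (z ^ (1 / 2 : ℂ)).re := by
  by_cases hz : z = 0
  · simp [hz]
  · rw [(cpow_half_eq hz).1]
    have h1 := Complex.neg_pi_lt_arg z
    have h2 := Complex.arg_le_pi z
    exact mul_nonneg (Real.exp_pos _).le
      (Real.cos_nonneg_of_neg_pi_div_two_le_of_le (by linarith) (by linarith))

theorem cpow_half_re_pos {z : ℂ} (hz : z ∈ Complex.slitPlane) : 0 < (z ^ (1 / 2 : ℂ)).re := by
  rw [(cpow_half_eq (Complex.slitPlane_ne_zero hz)).1]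
  have h1 := Complex.neg_pi_lt_arg z
  have h2 := lt_of_le_of_ne (Complex.arg_le_pi z) (Complex.mem_slitPlane_iff_arg.1 hz).1
  exact mul_pos (Real.exp_pos _) (Real.cos_pos_of_mem_Ioo ⟨by linarith, by linarith⟩)

theorem cpow_half_im_nonneg {z : ℂ} (hz : 0 ≤ z.im) : 0 ≤ (z ^ (1 / 2 : ℂ)).im := by
  by_cases h0 : z = 0
  · simp [h0]
  · rw [(cpow_half_eq h0).2]
    have h1 := Complex.arg_nonneg_iff.2 hz
    have h2 := Complex.arg_le_pi z
    exact mul_nonneg (Real.exp_pos _).le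
      (Real.sin_nonneg_of_nonneg_of_le_pi (by linarith) (by linarith))

/-- The principal root is continuous on the closed upper half-plane without `0`. -/
theorem continuousOn_cpow_half :
    ContinuousOn (fun z : ℂ => z ^ (1 / 2 : ℂ)) ({0}ᶜ ∩ {z | 0 ≤ z.im}) := by
  intro z hz
  have hz0 : z ≠ 0 := hz.1
  have hlog : ContinuousWithinAt Complex.log ({0}ᶜ ∩ {z | 0 ≤ z.im}) z := by
    by_cases hs : z ∈ Complex.slitPlane
    · exact (continuousAt_clog hs).continuousWithinAt
    · rw [Complex.mem_slitPlane_iff, not_or, not_lt, not_not] at hs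
      have hre : z.re < 0 := lt_of_le_of_ne hs.1 fun h => hz0 (Complex.ext h hs.2)
      exact (Complex.continuousWithinAt_log_of_re_neg_of_im_zero hre hs.2).mono
        Set.inter_subset_right
  refine ((hlog.mul continuousWithinAt_const).cexp ).congr
    (fun y hy => Complex.cpow_def_of_ne_zero hy.1 _) ?_
  · exact Complex.cpow_def_of_ne_zero hz0 _

theorem neg_mem_slitPlane {w : ℂ} (hw : w ∈ Pi0) : -w ∈ Complex.slitPlane := by
  rw [Complex.mem_slitPlane_iff]
  by_contra h
  rw [not_or, not_lt, not_not] at h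
  simp only [Complex.neg_re, Complex.neg_im, neg_eq_zero, Left.neg_nonpos_iff] at h
  exact hw ⟨h.2, h.1⟩

theorem mem_closedCutPlane_one_off {w : ℂ} : CutPoint.off w ∈ closedCutPlane 1 ↔ w ∈ Pi0 := by
  simp [closedCutPlane, cutPlane]

theorem mem_closedCutPlane_one_edge {s : Side} {x : ℝ} :
    CutPoint.edge s x ∈ closedCutPlane 1 ↔ 0 < x := by
  simp [closedCutPlane]

theorem sqrt_off_im_pos {w : ℂ} (hw : w ∈ Pi0) : 0 < (CutPoint.off w).sqrt.im := by
  simpa [CutPoint.sqrt] using cpow_half_re_pos (neg_mem_slitPlane hw)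

theorem sqrt_off_sq (w : ℂ) : (CutPoint.off w).sqrt ^ 2 = w := by
  simp only [CutPoint.sqrt, mul_pow, sq_cpow_half, Complex.I_sq]
  ring

theorem Side.sign_sq (s : Side) : s.sign ^ 2 = 1 := by
  cases s <;> simp [Side.sign]

theorem sqrt_edge_sq (s : Side) {x : ℝ} (hx : 0 ≤ x) : (CutPoint.edge s x).sqrt ^ 2 = x := by
  simp only [CutPoint.sqrt]
  norm_cast
  rw [mul_pow, s.sign_sq, Real.sq_sqrt hx, one_mul]

theorem CutPoint.sqrt_sq {P : CutPoint} (hP : P ∈ closedCutPlane 1) :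
    P.sqrt ^ 2 = P.toComplex := by
  cases P with
  | off w => exact sqrt_off_sq w
  | edge s x => exact sqrt_edge_sq s (mem_closedCutPlane_one_edge.1 hP).le

theorem CutPoint.sqrt_im_nonneg {P : CutPoint} (hP : P ∈ closedCutPlane 1) : 0 ≤ P.sqrt.im := by
  cases P with
  | off w => exact (sqrt_off_im_pos (mem_closedCutPlane_one_off.1 hP)).le
  | edge s x => exact (Complex.ofReal_im _).ge

theorem CutPoint.toComplex_ne_zero {P : CutPoint} (hP : P ∈ closedCutPlane 1) :
    P.toComplex ≠ 0 := by
  cases P with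
  | off w =>
    rintro rfl
    exact mem_closedCutPlane_one_off.1 hP ⟨rfl, le_rfl⟩
  | edge s x =>
    exact Complex.ofReal_ne_zero.2 (mem_closedCutPlane_one_edge.1 hP).ne'

theorem CutPoint.sqrt_ne_zero {P : CutPoint} (hP : P ∈ closedCutPlane 1) : P.sqrt ≠ 0 := by
  intro h
  have := CutPoint.sqrt_sq hP
  rw [h] at this
  exact CutPoint.toComplex_ne_zero hP (by rw [← this]; simp)

/-- Every `k ≠ 0` in the closed upper half-plane is the root of a point of the cut plane. -/
theorem exists_sqrt_eq {k : ℂ} (hk : k ≠ 0) (him : 0 ≤ k.im) :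
    ∃ P ∈ closedCutPlane 1, P.sqrt = k := by
  rcases him.lt_or_eq with him | him
  · have hP : k ^ 2 ∈ Pi0 := by
      rintro ⟨h1, h2⟩
      simp only [pow_two, Complex.mul_im, Complex.mul_re] at h1 h2
      have h3 : k.re = 0 := by
        have : k.re * k.im = 0 := by linarith
        exact (mul_eq_zero.1 this).resolve_right him.ne'
      rw [h3] at h2
      nlinarith
    refine ⟨.off (k ^ 2), mem_closedCutPlane_one_off.2 hP, ?_⟩
    rcases sq_eq_sq_iff_eq_or_eq_neg.1 (sqrt_off_sq (k ^ 2)) with h | h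
    · exact h
    · have := sqrt_off_im_pos hP
      rw [h, Complex.neg_im] at this
      linarith
  · have hre : k.re ≠ 0 := fun h => hk (Complex.ext h him.symm)
    refine ⟨.edge (if 0 < k.re then .upper else .lower) (k.re ^ 2),
      mem_closedCutPlane_one_edge.2 (by positivity), ?_⟩
    have e : k = (k.re : ℂ) := Complex.ext rfl (by simpa using him.symm)
    conv_rhs => rw [e]
    simp only [CutPoint.sqrt, Real.sqrt_sq_eq_abs]
    congr 1
    split_ifs with h
    · simp [Side.sign, abs_of_pos h]
    · simp [Side.sign, abs_of_nonpos (not_lt.1 h)]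

section Scale

variable {γ : ℝ}

theorem eq_or_eq_neg_one (hγ : |γ| = 1) : γ = 1 ∨ γ = -1 := by
  rcases abs_cases γ with h | h
  · left; linarith
  · right; linarith

theorem CutPoint.scale_toComplex (P : CutPoint) :
    (P.scale γ).toComplex = γ * P.toComplex := by
  cases P <;> simp [CutPoint.scale, CutPoint.toComplex]

theorem CutPoint.scale_mem {P : CutPoint} (hP : P ∈ closedCutPlane γ) :
    P.scale γ ∈ closedCutPlane 1 := by
  cases P with
  | off z => exact mem_closedCutPlane_one_off.2 hP
  | edge s x => exact mem_closedCutPlane_one_edge.2 hP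

theorem norm_sqrt_scale_sq (hγ : |γ| = 1) {P : CutPoint} (hP : P ∈ closedCutPlane γ) :
    ‖(P.scale γ).sqrt‖ ^ 2 = ‖P.toComplex‖ := by
  rw [← norm_pow, CutPoint.sqrt_sq (CutPoint.scale_mem hP), CutPoint.scale_toComplex, norm_mul,
    Complex.norm_real, Real.norm_eq_abs, hγ, one_mul]

theorem onSide_toComplex (s : Side) (z : ℂ) (hγ : |γ| = 1) : (onSide γ s z).toComplex = z := by
  unfold onSide
  split_ifs with h
  · rfl
  · simp only [cutPlane, Pi0, Set.mem_ofPred_eq, not_not, Complex.re_ofReal_mul,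
      Complex.im_ofReal_mul] at h
    have h0 : γ ≠ 0 := by rintro rfl; simp at hγ
    have : z.im = 0 := (mul_eq_zero.1 h.1).resolve_left h0
    exact Complex.ext rfl (by simpa [CutPoint.toComplex] using this.symm)

theorem onSide_mem (s : Side) {z : ℂ} (hz : z ≠ 0) (hγ : |γ| = 1) :
    onSide γ s z ∈ closedCutPlane γ := by
  have h1 := onSide_toComplex s z hγ
  unfold onSide at h1 ⊢
  split_ifs at h1 ⊢ with h
  · exact h
  · simp only [cutPlane, Pi0, Set.mem_ofPred_eq, not_not, Complex.re_ofReal_mul,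
      Complex.im_ofReal_mul] at h
    have h0 : γ ≠ 0 := by rintro rfl; simp at hγ
    refine lt_of_le_of_ne h.2 fun h2 => hz ?_
    rw [← h1, (mul_eq_zero.1 h2.symm).resolve_left h0]
    simp [CutPoint.toComplex]

open Classical in
theorem sqrt_onSide_upper {w : ℂ} (hw : 0 ≤ w.im) :
    (if w ∈ Pi0 then CutPoint.off w else CutPoint.edge .upper w.re).sqrt = w ^ (1 / 2 : ℂ) := by
  split_ifs with h
  · rcases sq_eq_sq_iff_eq_or_eq_neg.1 ((sqrt_off_sq w).trans (sq_cpow_half w).symm) with h1 | h1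
    · exact h1
    · have h2 := sqrt_off_im_pos h
      have h3 := cpow_half_im_nonneg hw
      rw [h1, Complex.neg_im] at h2
      linarith
  · simp only [Pi0, Set.mem_ofPred_eq, not_not] at h
    have e : w = (w.re : ℂ) := Complex.ext rfl (by simpa using h.1)
    conv_rhs => rw [e]
    simp only [CutPoint.sqrt, Side.sign, one_mul]
    rw [Real.sqrt_eq_rpow, Complex.ofReal_cpow h.2]
    norm_num

open Classical in
/-- At the lower edge `-w` lies on the branch cut of the principal root, whose value there is the
limit from above; this is the limit needed for `w` in the lower half-plane. -/
theorem sqrt_onSide_lower {w : ℂ} (hw0 : w ≠ 0) :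
    (if w ∈ Pi0 then CutPoint.off w else CutPoint.edge .lower w.re).sqrt =
      Complex.I * (-w) ^ (1 / 2 : ℂ) := by
  split_ifs with h
  · rfl
  · simp only [Pi0, Set.mem_ofPred_eq, not_not] at h
    have e : w = (w.re : ℂ) := Complex.ext rfl (by simpa using h.1)
    have hre : 0 < w.re := lt_of_le_of_ne h.2 fun h2 => hw0 (by rw [e, ← h2]; simp)
    have h1 : (-w) ^ (1 / 2 : ℂ) = Complex.I * ((w.re : ℂ) ^ (1 / 2 : ℂ)) := by
      conv_lhs => rw [e, ← Complex.ofReal_neg]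
      rw [Complex.ofReal_cpow_of_nonpos (by linarith)]
      rw [show (Real.pi : ℂ) * Complex.I * (1 / 2) = Real.pi / 2 * Complex.I by ring,
        Complex.exp_pi_div_two_mul_I]
      push_cast
      rw [neg_neg, mul_comm]
    rw [h1]
    simp only [CutPoint.sqrt, Side.sign]
    rw [Real.sqrt_eq_rpow, ← mul_assoc, Complex.I_mul_I]
    push_cast
    rw [Complex.ofReal_cpow h.2]
    norm_num

open Classical in
theorem continuousOn_sqrt_onSide (hγ : |γ| = 1) (s : Side) :
    ContinuousOn (fun z => ((onSide γ s z).scale γ).sqrt) ({0}ᶜ ∩ closedHalfPlane s) := by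
  -- Multiplication by `γ` carries the side `s` of `z` to the side `s'` of `w = γ z`.
  obtain ⟨s', hs', hsign⟩ : ∃ s' : Side, (if 0 < γ then s else s.opp) = s' ∧
      s'.sign = γ * s.sign := by
    refine ⟨_, rfl, ?_⟩
    rcases eq_or_eq_neg_one hγ with rfl | rfl
    · simp
    · rw [if_neg (by norm_num)]
      cases s <;> simp [Side.sign, Side.opp]
  have hγ2 : γ * γ = 1 := by
    rcases eq_or_eq_neg_one hγ with rfl | rfl <;> norm_num
  have h0 : γ ≠ 0 := by rintro rfl; simp at hγ
  have hscale : ∀ z, (onSide γ s z).scale γ =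
      if (γ : ℂ) * z ∈ Pi0 then CutPoint.off (γ * z) else CutPoint.edge s' ((γ : ℂ) * z).re := by
    intro z
    unfold onSide
    by_cases h : z ∈ cutPlane γ
    · rw [if_pos h, if_pos (show (γ : ℂ) * z ∈ Pi0 from h)]
      rfl
    · rw [if_neg h, if_neg (show ¬ (γ : ℂ) * z ∈ Pi0 from h)]
      simp [CutPoint.scale, hs']
  have hne : ∀ z ∈ ({0}ᶜ ∩ closedHalfPlane s : Set ℂ), (γ : ℂ) * z ≠ 0 := fun z hz =>
    mul_ne_zero (Complex.ofReal_ne_zero.2 h0) hz.1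
  have him : ∀ z ∈ ({0}ᶜ ∩ closedHalfPlane s : Set ℂ), 0 ≤ s'.sign * ((γ : ℂ) * z).im := by
    intro z hz
    have : 0 ≤ s.sign * z.im := hz.2
    rw [hsign, Complex.im_ofReal_mul]
    have e : γ * s.sign * (γ * z.im) = γ * γ * (s.sign * z.im) := by ring
    rwa [e, hγ2, one_mul]
  simp only [hscale]
  cases s' with
  | upper =>
    simp only [Side.sign, one_mul] at him
    refine (continuousOn_cpow_half.comp (f := fun z => (γ : ℂ) * z) (by fun_prop)
      fun z hz => ⟨hne z hz, him z hz⟩).congr fun z hz => ?_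
    exact sqrt_onSide_upper (him z hz)
  | lower =>
    simp only [Side.sign, neg_mul, one_mul] at him
    have hc := continuousOn_cpow_half.comp (s := ({0}ᶜ ∩ closedHalfPlane s : Set ℂ))
      (f := fun z => -((γ : ℂ) * z)) (by fun_prop)
      fun z hz => ⟨neg_ne_zero.2 (hne z hz), him z hz⟩
    refine (continuousOn_const (c := Complex.I).mul hc).congr fun z hz => ?_
    exact sqrt_onSide_lower (hne z hz)

/-- A function of the root `k` that is analytic for `Im k > 0` and continuous for `Im k ≥ 0` is, as
a function on the cut plane, analytic off the cut and continuous up to its edges. -/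
theorem AnalyticUpToCut.comp_sqrt (hγ : |γ| = 1) {V U : Set ℂ} {G : ℂ → ℂ} (hV : (0 : ℂ) ∉ V)
    (hVU : ∀ P ∈ closedCutPlane γ, P.toComplex ∈ V → (P.scale γ).sqrt ∈ U)
    (hd : DifferentiableOn ℂ G (U ∩ {k | 0 < k.im}))
    (hc : ContinuousOn G (U ∩ {k | 0 ≤ k.im})) :
    AnalyticUpToCut γ V (fun P => G (P.scale γ).sqrt) := by
  constructor
  · refine hd.comp (g := G) (f := fun z => ((CutPoint.off z).scale γ).sqrt) ?_ ?_
    · intro z hz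
      have hz' := neg_mem_slitPlane (show (γ : ℂ) * z ∈ Pi0 from hz.2)
      refine DifferentiableAt.differentiableWithinAt ?_
      simp only [CutPoint.scale, CutPoint.sqrt]
      refine DifferentiableAt.const_mul ?_ _
      exact DifferentiableAt.cpow_const (by fun_prop) hz'
    · intro z hz
      exact ⟨hVU (.off z) hz.2 hz.1, sqrt_off_im_pos hz.2⟩
  · intro s
    have hV' : ∀ z ∈ V, z ≠ 0 := fun z hz h => hV (h ▸ hz)
    refine hc.comp ((continuousOn_sqrt_onSide hγ s).mono ?_) ?_
    · exact fun z hz => ⟨hV' z hz.1, hz.2⟩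
    · intro z hz
      have hm := onSide_mem s (hV' z hz.1) hγ
      refine ⟨hVU _ hm ?_, CutPoint.sqrt_im_nonneg (CutPoint.scale_mem hm)⟩
      rw [onSide_toComplex s z hγ]
      exact hz.1

end Scale

/-! ### The phases `θ_n` as functions of the root -/

section

variable {σ τ : ℝ} {L : ℕ} {p : ℕ → ℝ} {q : Polynomial ℂ} {ε r R : ℝ}

/-- The function `k n ^ (-σ/2) √(1 + s_n(k²))` with the principal root. For `r ≤ |k| ≤ R` and large
`n` it is analytic in `k`, and it is then the phase `θ_n` at the point with root `k`. -/
noncomputable def localPhase (σ τ : ℝ) (L : ℕ) (p : ℕ → ℝ) (n : ℕ) (k : ℂ) : ℂ :=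
  k * (((n : ℝ) ^ (-(σ / 2)) : ℝ) : ℂ) * (1 + relCorrection σ τ L p n (k ^ 2)) ^ (1 / 2 : ℂ)

theorem norm_sqrt_one_add_sub_one_le (s : ℂ) : ‖(1 + s) ^ (1 / 2 : ℂ) - 1‖ ≤ ‖s‖ := by
  set x := (1 + s) ^ (1 / 2 : ℂ)
  have h1 : (x - 1) * (x + 1) = s := by
    have := sq_cpow_half (1 + s)
    linear_combination this
  have h2 : 1 ≤ ‖x + 1‖ := by
    have h3 := Complex.re_le_norm (x + 1)
    have h4 : 0 ≤ x.re := cpow_half_re_nonneg (1 + s)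
    simp only [Complex.add_re, Complex.one_re] at h3
    linarith
  calc ‖x - 1‖ ≤ ‖x - 1‖ * ‖x + 1‖ := le_mul_of_one_le_right (norm_nonneg _) h2
    _ = ‖s‖ := by rw [← norm_mul, h1]

theorem rpow_half_mul_self {n : ℕ} (hn : 1 ≤ n) :
    (((n : ℝ) ^ (-(σ / 2)) : ℝ) : ℂ) * (((n : ℝ) ^ (-(σ / 2)) : ℝ) : ℂ) =
      (((n : ℝ) ^ (-σ) : ℝ) : ℂ) := by
  have hn0 : (0 : ℝ) < n := by exact_mod_cast hn
  norm_cast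
  rw [← Real.rpow_add hn0]
  congr 1
  ring

theorem localPhase_sq {n : ℕ} (hn : 1 ≤ n) {k : ℂ} (hk : k ≠ 0) :
    localPhase σ τ L p n k ^ 2 = TSeq σ τ L p n (k ^ 2) := by
  rw [TSeq_eq hn (pow_ne_zero 2 hk), localPhase, mul_pow, sq_cpow_half]
  linear_combination k ^ 2 * (1 + relCorrection σ τ L p n (k ^ 2)) *
    rpow_half_mul_self (σ := σ) hn

/-- The root of `T_n(k²)` in the closed quadrant of `k` is the local phase. -/
theorem eq_localPhase {n : ℕ} (hn : 1 ≤ n) {k θ : ℂ} (hk : k ≠ 0)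
    (hs : ‖relCorrection σ τ L p n (k ^ 2)‖ ≤ 1 / 2) (hsq : θ ^ 2 = TSeq σ τ L p n (k ^ 2))
    (him : 0 ≤ k.im * θ.im) (hre : 0 ≤ k.re * θ.re) : θ = localPhase σ τ L p n k := by
  rw [← localPhase_sq hn hk] at hsq
  rcases sq_eq_sq_iff_eq_or_eq_neg.1 hsq with h | h
  · exact h
  exfalso
  have hn0 : (0 : ℝ) < n := by exact_mod_cast hn
  set d : ℝ := (n : ℝ) ^ (-(σ / 2)) with hd
  have hd0 : 0 < d := by positivity
  have h1 : θ + k * (d : ℂ) =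
      k * (d : ℂ) * -((1 + relCorrection σ τ L p n (k ^ 2)) ^ (1 / 2 : ℂ) - 1) := by
    rw [h, localPhase]
    ring
  have h2 : ‖θ + k * (d : ℂ)‖ ≤ ‖k‖ * d * (1 / 2) := by
    rw [h1, norm_mul, norm_mul, norm_neg, Complex.norm_real, Real.norm_of_nonneg hd0.le]
    gcongr
    exact (norm_sqrt_one_add_sub_one_le _).trans hs
  have h3 : ‖k‖ * d ≤ ‖θ + k * (d : ℂ)‖ := by
    have e : ‖k‖ * d = ‖k * (d : ℂ)‖ := by
      rw [norm_mul, Complex.norm_real, Real.norm_of_nonneg hd0.le]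
    rw [e, Complex.norm_def, Complex.norm_def]
    apply Real.sqrt_le_sqrt
    simp only [Complex.normSq_apply, Complex.add_re, Complex.add_im, Complex.mul_re,
      Complex.mul_im, Complex.ofReal_re, Complex.ofReal_im, mul_zero, sub_zero, zero_add]
    nlinarith [mul_nonneg hre hd0.le, mul_nonneg him hd0.le, sq_nonneg θ.re, sq_nonneg θ.im]
  have h4 : 0 < ‖k‖ * d := mul_pos (norm_pos_iff.2 hk) hd0
  linarith

theorem abs_im_pow_le (t : ℂ) (l : ℕ) : |(t ^ (l + 1)).im| ≤ (l + 1) * ‖t‖ ^ l * |t.im| := by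
  induction l with
  | zero => simp
  | succ l ih =>
    have h1 : |(t ^ (l + 1)).re| ≤ ‖t‖ ^ (l + 1) := by
      rw [← norm_pow]
      exact Complex.abs_re_le_norm _
    rw [pow_succ, Complex.mul_im]
    calc _ ≤ |(t ^ (l + 1)).re| * |t.im| + |(t ^ (l + 1)).im| * |t.re| := by
          rw [← abs_mul, ← abs_mul]
          exact abs_add_le _ _
      _ ≤ ‖t‖ ^ (l + 1) * |t.im| + ((l + 1) * ‖t‖ ^ l * |t.im|) * ‖t‖ := by
          gcongr
          exact Complex.abs_re_le_norm _
      _ = _ := by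
          push_cast
          ring

/-- For small `t`, the imaginary part of `t + P_L(t)` is comparable to that of `t`. -/
theorem exists_abs_im_sub_le (L : ℕ) (p : ℕ → ℝ) : ∃ δ : ℝ, 0 < δ ∧ ∀ t : ℂ, ‖t‖ ≤ δ →
    |(t + ∑ l ∈ Finset.Icc 2 L, (p l : ℂ) * t ^ l).im - t.im| ≤ 1 / 2 * |t.im| := by
  set B : ℝ := ∑ l ∈ Finset.Icc 2 L, |p l| * l with hB
  have hB0 : 0 ≤ B := Finset.sum_nonneg fun l _ => by positivity
  refine ⟨min 1 (1 / (2 * (1 + B))), by positivity, fun t ht => ?_⟩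
  have ht1 : ‖t‖ ≤ 1 := ht.trans (min_le_left _ _)
  have ht2 : B * ‖t‖ ≤ 1 / 2 := by
    have := ht.trans (min_le_right _ _)
    rw [le_div_iff₀ (by positivity)] at this
    nlinarith [norm_nonneg t]
  rw [Complex.add_im, add_sub_cancel_left, Complex.im_sum]
  calc _ ≤ ∑ l ∈ Finset.Icc 2 L, |((p l : ℂ) * t ^ l).im| := Finset.abs_sum_le_sum_abs _ _
    _ ≤ ∑ l ∈ Finset.Icc 2 L, |p l| * l * (‖t‖ * |t.im|) := by
        refine Finset.sum_le_sum fun l hl => ?_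
        obtain ⟨j, rfl⟩ : ∃ j, l = j + 1 + 1 :=
          ⟨l - 2, by have := (Finset.mem_Icc.1 hl).1; omega⟩
        rw [Complex.im_ofReal_mul, abs_mul, mul_assoc]
        refine mul_le_mul_of_nonneg_left ((abs_im_pow_le t (j + 1)).trans ?_) (abs_nonneg _)
        have : ‖t‖ ^ (j + 1) ≤ ‖t‖ := pow_le_of_le_one (norm_nonneg _) ht1 (by omega)
        rw [mul_assoc]
        push_cast
        gcongr
    _ = B * ‖t‖ * |t.im| := by rw [← Finset.sum_mul, mul_assoc]
    _ ≤ _ := mul_le_mul_of_nonneg_right ht2 (abs_nonneg _)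

theorem tSeq_im (n : ℕ) (w : ℂ) : (tSeq σ τ n w).im = w.im * (n : ℝ) ^ (-σ) := by
  simp [tSeq, -Complex.ofReal_mul, -Complex.ofReal_neg]

/-- For large `n`, `T_n` maps the part of the two-sided cut plane over an annulus into the two-sided
cut plane, and `θ_n` is the local phase. -/
theorem eventually_theta_eq (hσ0 : 0 < σ) (hσ1 : σ ≤ 1) (hr : 0 < r)
    (hε : SmallExponent σ L ε) :
    ∀ᶠ n : ℕ in atTop, ∀ k ∈ closedAnnulus r R,
      ‖relCorrection σ τ L p n (k ^ 2)‖ ≤ 1 / 2 ∧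
      ∀ P ∈ closedCutPlane 1, P.sqrt = k →
        TPoint σ τ L p n P ∈ closedCutPlane 1 ∧ theta σ τ L p n P = localPhase σ τ L p n k := by
  obtain ⟨δ, hδ0, hδ⟩ := exists_abs_im_sub_le L p
  have hs := (unifSymbol_relCorrection (σ := σ) (τ := τ) (p := p) (R := R) hr hε).1.eventually_le
    (by linarith [hε.pos]) (δ := 1 / 2) (by norm_num)
  have ht := (unifSymbol_tSeq (σ := σ) (τ := τ) (r := r) (R := R) hσ1).1.eventually_le
    (by linarith) hδ0
  filter_upwards [hs, ht, eventually_ge_atTop 1] with n hs ht hn k hk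
  refine ⟨hs k hk, fun P hP hPk => ?_⟩
  have hn0 : (0 : ℝ) < n := by exact_mod_cast hn
  have hk0 : k ≠ 0 := norm_pos_iff.1 (hr.trans_le hk.1)
  have hsq : k ^ 2 = P.toComplex := by rw [← hPk]; exact CutPoint.sqrt_sq hP
  have hkim : 0 ≤ k.im := by rw [← hPk]; exact CutPoint.sqrt_im_nonneg hP
  set w := P.toComplex with hw
  have hd0 : (0 : ℝ) < (n : ℝ) ^ (-σ) := by positivity
  have him := hδ (tSeq σ τ n w) (by rw [← hsq]; exact ht k hk)
  rw [tSeq_im, show tSeq σ τ n w + ∑ l ∈ Finset.Icc 2 L, (p l : ℂ) * tSeq σ τ n w ^ l =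
    TSeq σ τ L p n w from rfl, abs_mul, abs_of_pos hd0] at him
  have hs' := hs k hk
  have hw0 : w ≠ 0 := by rw [← hsq]; exact pow_ne_zero 2 hk0
  have hTeq := TSeq_eq (σ := σ) (τ := τ) (L := L) (p := p) hn hw0
  rw [hsq] at hs'
  -- On the real axis `T_n` is real, and it has the sign of `w`.
  have hreal : w.im = 0 → (TSeq σ τ L p n w).im = 0 ∧ ∃ c : ℝ, 0 < c ∧
      (TSeq σ τ L p n w).re = c * w.re := by
    intro h0
    rw [h0] at him
    refine ⟨by simpa using him, (n : ℝ) ^ (-σ) * (1 + (relCorrection σ τ L p n w).re), ?_, ?_⟩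
    · have := (abs_le.1 ((Complex.abs_re_le_norm (relCorrection σ τ L p n w)).trans hs')).1
      exact mul_pos hd0 (by linarith)
    · have e : w = (w.re : ℂ) := Complex.ext rfl (by simpa using h0)
      rw [hTeq]
      conv_lhs => rw [e, mul_assoc, Complex.re_ofReal_mul, Complex.re_ofReal_mul]
      rw [← e]
      simp only [Complex.add_re, Complex.one_re]
      ring
  cases P with
  | off z =>
    change w = z at hw
    rw [← hw] at hPk hP ⊢
    have hwP := mem_closedCutPlane_one_off.1 hP
    have hTP : TSeq σ τ L p n w ∈ Pi0 := by
      rintro ⟨h1, h2⟩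
      have h3 : w.im = 0 := by
        rw [h1, zero_sub, abs_neg, abs_mul, abs_of_pos hd0] at him
        by_contra h
        nlinarith [mul_pos (abs_pos.2 h) hd0]
      obtain ⟨-, c, hc, h4⟩ := hreal h3
      exact hwP ⟨h3, by nlinarith⟩
    refine ⟨mem_closedCutPlane_one_off.2 hTP, ?_⟩
    have hkpos : 0 < k.im := by rw [← hPk]; exact sqrt_off_im_pos hwP
    have hθpos := sqrt_off_im_pos hTP
    have hθsq := sqrt_off_sq (TSeq σ τ L p n w)
    refine eq_localPhase hn hk0 (by rw [hsq]; exact hs') (by rw [hsq]; exact hθsq)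
      (mul_nonneg hkim hθpos.le) ?_
    change 0 ≤ k.re * (CutPoint.off (TSeq σ τ L p n w)).sqrt.re
    set θ := (CutPoint.off (TSeq σ τ L p n w)).sqrt
    have h1 : w.im = 2 * (k.re * k.im) := by rw [← hsq, pow_two, Complex.mul_im]; ring
    have h2 : (TSeq σ τ L p n w).im = 2 * (θ.re * θ.im) := by
      rw [← hθsq, pow_two, Complex.mul_im]; ring
    have h3 : 0 ≤ w.im * (TSeq σ τ L p n w).im := by
      obtain ⟨h4, h5⟩ := abs_le.1 him
      rcases le_total 0 w.im with h6 | h6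
      · rw [abs_of_nonneg h6] at h4
        exact mul_nonneg h6 (by nlinarith)
      · rw [abs_of_nonpos h6] at h5
        exact mul_nonneg_of_nonpos_of_nonpos h6 (by nlinarith)
    rw [h1, h2] at h3
    by_contra h
    push Not at h
    nlinarith [mul_pos hkpos hθpos]
  | edge s x =>
    change w = (x : ℂ) at hw
    have hx := mem_closedCutPlane_one_edge.1 hP
    obtain ⟨h1, c, hc, h2⟩ := hreal (by rw [hw, Complex.ofReal_im])
    have hre : 0 < (TSeq σ τ L p n (x : ℂ)).re := by
      rw [← hw, h2, hw, Complex.ofReal_re]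
      positivity
    have hTre : ((TSeq σ τ L p n (x : ℂ)).re : ℂ) = TSeq σ τ L p n (x : ℂ) := by
      refine Complex.ext rfl ?_
      rw [← hw, h1, Complex.ofReal_im]
    refine ⟨mem_closedCutPlane_one_edge.2 hre, ?_⟩
    refine eq_localPhase hn hk0 (by rw [hsq]; exact hs') ?_ ?_ ?_
    · rw [hsq, hw]
      exact (sqrt_edge_sq s hre.le).trans hTre
    · rw [← hPk]
      simp [CutPoint.sqrt]
    · rw [← hPk]
      simp only [theta, TPoint, CutPoint.sqrt, Complex.ofReal_re]
      have e : s.sign * Real.sqrt x * (s.sign * Real.sqrt (TSeq σ τ L p n (x : ℂ)).re) =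
          s.sign ^ 2 * (Real.sqrt x * Real.sqrt (TSeq σ τ L p n (x : ℂ)).re) := by ring
      rw [e, s.sign_sq]
      positivity

theorem eventually_localPhase_im_nonneg (hσ0 : 0 < σ) (hσ1 : σ ≤ 1) (hr : 0 < r)
    (hε : SmallExponent σ L ε) :
    ∀ᶠ n : ℕ in atTop, ∀ k ∈ closedAnnulus r R, 0 ≤ k.im → 0 ≤ (localPhase σ τ L p n k).im := by
  filter_upwards [eventually_theta_eq (τ := τ) (p := p) (R := R) hσ0 hσ1 hr hε] with n h k hk hkim
  obtain ⟨P, hP, hPk⟩ := exists_sqrt_eq (norm_pos_iff.1 (hr.trans_le hk.1)) hkim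
  obtain ⟨h1, h2⟩ := (h k hk).2 P hP hPk
  rw [← h2]
  exact CutPoint.sqrt_im_nonneg h1

/-- The global phase differs from `θ_n` by `O(n ^ (-2))`. -/
theorem unifBigO_phase_sub_localPhase (hr : 0 < r) (hσ0 : 0 < σ) (hε : SmallExponent σ L ε)
    (hq : q.coeff 0 = 1) {K : ℕ} (hK : 2 ≤ (K + 1) * ε)
    (hqK : (Polynomial.X : Polynomial ℂ) ^ (K + 1) ∣ q ^ 2 - (1 + Polynomial.X)) :
    UnifBigO (closedAnnulus r R) (-2) (fun n k =>
      phase σ τ L p q n k - localPhase σ τ L p n k) := by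
  obtain ⟨g, hg⟩ := hqK
  have h0 := hε.pos
  have hs := unifSymbol_relCorrection (τ := τ) (p := p) (R := R) hr hε
  have hsq : UnifBigO (closedAnnulus r R) (-2) (fun n k =>
      relCorrection σ τ L p n (k ^ 2) ^ (K + 1) *
        g.eval (relCorrection σ τ L p n (k ^ 2))) :=
    (hs.1.pow (K + 1) (e := -2) (by push_cast; linarith)).mul
      (hs.polynomial_eval g (by linarith)).1 (by linarith)
  have hq1 := (unifSymbol_eval_sub_one hq hs (by linarith)).1.eventually_le
    (by linarith) (δ := 1 / 2) (by norm_num)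
  have hs1 := hs.1.eventually_le (by linarith) (δ := 1 / 2) (by norm_num)
  have hdiff : UnifBigO (closedAnnulus r R) (-2) (fun n k =>
      q.eval (relCorrection σ τ L p n (k ^ 2)) -
        (1 + relCorrection σ τ L p n (k ^ 2)) ^ (1 / 2 : ℂ)) := by
    refine IsBigO.trans (IsBigO.of_bound 1 ?_) hsq
    rw [eventually_prod_principal_iff]
    filter_upwards [hq1, hs1] with n hq1 hs1 k hk
    set s := relCorrection σ τ L p n (k ^ 2)
    set x := (1 + s) ^ (1 / 2 : ℂ) with hx
    have h := congrArg (Polynomial.eval s) hg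
    simp only [Polynomial.eval_sub, Polynomial.eval_pow, Polynomial.eval_add, Polynomial.eval_one,
      Polynomial.eval_X, Polynomial.eval_mul] at h
    have h1 : s ^ (K + 1) * g.eval s = (q.eval s - x) * (q.eval s + x) := by
      have := sq_cpow_half (1 + s)
      rw [← h]
      linear_combination this
    have h2 : 1 ≤ ‖q.eval s + x‖ := by
      have h3 : ‖x - 1‖ ≤ 1 / 2 := (norm_sqrt_one_add_sub_one_le s).trans (hs1 k hk)
      have h4 := hq1 k hk
      have h5 : (2 : ℂ) = (q.eval s + x) - ((q.eval s - 1) + (x - 1)) := by ring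
      have h6 := norm_sub_le (q.eval s + x) ((q.eval s - 1) + (x - 1))
      have h7 := norm_add_le (q.eval s - 1) (x - 1)
      rw [← h5, Complex.norm_ofNat] at h6
      linarith
    rw [h1, norm_mul, one_mul]
    exact le_mul_of_one_le_right (norm_nonneg _) h2
  have hk := UnifBigO.of_bounded (S := closedAnnulus r R) (c := fun k => k) fun k hk => hk.2
  refine ((hk.mul (UnifBigO.rpow (-(σ / 2))) (e := 0) (by linarith)).mul hdiff (e := -2)
    (by linarith)).congr' (Eventually.of_forall fun n k _ => ?_)
  unfold phase localPhase
  ring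

/-! ### Analyticity of the phases -/

theorem differentiableAt_relCorrection (n : ℕ) {k : ℂ} (hk : k ≠ 0) :
    DifferentiableAt ℂ (fun k => relCorrection σ τ L p n (k ^ 2)) k := by
  have h : k ^ 2 ≠ 0 := pow_ne_zero 2 hk
  unfold relCorrection tSeq
  fun_prop (disch := assumption)

theorem differentiableAt_phase (n : ℕ) {k : ℂ} (hk : k ≠ 0) :
    DifferentiableAt ℂ (phase σ τ L p q n) k := by
  have h := differentiableAt_relCorrection (σ := σ) (τ := τ) (L := L) (p := p) n hk
  unfold phase
  exact (differentiableAt_id.mul_const _).mul (q.differentiable.differentiableAt.comp k h)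

theorem differentiableAt_localPhase (n : ℕ) {k : ℂ} (hk : k ≠ 0)
    (hs : ‖relCorrection σ τ L p n (k ^ 2)‖ ≤ 1 / 2) :
    DifferentiableAt ℂ (localPhase σ τ L p n) k := by
  have h := differentiableAt_relCorrection (σ := σ) (τ := τ) (L := L) (p := p) n hk
  unfold localPhase
  refine (differentiableAt_id.mul_const _).mul ((h.const_add 1).cpow_const ?_)
  rw [Complex.mem_slitPlane_iff]
  left
  have := (abs_le.1 ((Complex.abs_re_le_norm (relCorrection σ τ L p n (k ^ 2))).trans hs)).1
  simp only [Complex.add_re, Complex.one_re]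
  linarith

end

/-! ### The ansatz and its defect -/

section

variable {σ τ : ℝ} {L : ℕ} {p : ℕ → ℝ} {q : Polynomial ℂ} {ε r R α β : ℝ} {a B : ℕ → ℝ}

/-- The sum of the global phases up to `n`. -/
noncomputable def phaseSum (σ τ : ℝ) (L : ℕ) (p : ℕ → ℝ) (q : Polynomial ℂ) (n : ℕ) (k : ℂ) : ℂ :=
  ∑ m ∈ Finset.range (n + 1), phase σ τ L p q m k

/-- The global ansatz `n ^ (-σ/4) exp(i Φ_n(k))`. -/
noncomputable def amplitude (σ τ : ℝ) (L : ℕ) (p : ℕ → ℝ) (q : Polynomial ℂ) (n : ℕ) (k : ℂ) : ℂ :=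
  (((n : ℝ) ^ (-(σ / 4)) : ℝ) : ℂ) * Complex.exp (Complex.I * phaseSum σ τ L p q n k)

/-- The defect of the ansatz in the equation
`a (n - 1) * u (n - 1) + a n * u (n + 1) = (B n - k²) * u n`. -/
noncomputable def defect (a B : ℕ → ℝ) (σ τ : ℝ) (L : ℕ) (p : ℕ → ℝ) (q : Polynomial ℂ)
    (n : ℕ) (k : ℂ) : ℂ :=
  a (n - 1) * amplitude σ τ L p q (n - 1) k + a n * amplitude σ τ L p q (n + 1) k -
    (B n - k ^ 2) * amplitude σ τ L p q n k

/-- The factor `exp(-2 i Φ_n)` in the reciprocal of the squared ansatz. Its modulus is essentially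
nondecreasing in `n` for `Im k ≥ 0`. -/
noncomputable def expFactor (σ τ : ℝ) (L : ℕ) (p : ℕ → ℝ) (q : Polynomial ℂ) (n : ℕ) (k : ℂ) : ℂ :=
  Complex.exp (-(2 * (Complex.I * phaseSum σ τ L p q n k)))

theorem phaseSum_succ (n : ℕ) (k : ℂ) :
    phaseSum σ τ L p q (n + 1) k = phaseSum σ τ L p q n k + phase σ τ L p q (n + 1) k :=
  Finset.sum_range_succ _ _

theorem amplitude_ne_zero {n : ℕ} (hn : 1 ≤ n) (k : ℂ) : amplitude σ τ L p q n k ≠ 0 := by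
  have hn0 : (0 : ℝ) < n := by exact_mod_cast hn
  refine mul_ne_zero (Complex.ofReal_ne_zero.2 ?_) (Complex.exp_ne_zero _)
  positivity

theorem differentiableAt_amplitude (n : ℕ) {k : ℂ} (hk : k ≠ 0) :
    DifferentiableAt ℂ (amplitude σ τ L p q n) k := by
  unfold amplitude phaseSum
  refine DifferentiableAt.const_mul (DifferentiableAt.cexp (DifferentiableAt.const_mul ?_ _)) _
  exact DifferentiableAt.fun_sum fun m _ => differentiableAt_phase m hk

theorem norm_amplitude_sq_mul (n : ℕ) (hn : 1 ≤ n) (k : ℂ) :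
    ‖amplitude σ τ L p q n k‖ * ‖amplitude σ τ L p q n k‖ * ‖expFactor σ τ L p q n k‖ =
      (n : ℝ) ^ (-(σ / 2)) := by
  have hn0 : (0 : ℝ) < n := by exact_mod_cast hn
  have h1 : amplitude σ τ L p q n k * amplitude σ τ L p q n k * expFactor σ τ L p q n k =
      (((n : ℝ) ^ (-(σ / 2)) : ℝ) : ℂ) := by
    have h2 : (n : ℝ) ^ (-(σ / 4)) * (n : ℝ) ^ (-(σ / 4)) = (n : ℝ) ^ (-(σ / 2)) := by
      rw [← Real.rpow_add hn0]
      congr 1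
      ring
    have h3 : Complex.exp (Complex.I * phaseSum σ τ L p q n k) *
        Complex.exp (Complex.I * phaseSum σ τ L p q n k) * expFactor σ τ L p q n k = 1 := by
      rw [expFactor, ← Complex.exp_add, ← Complex.exp_add, ← Complex.exp_zero]
      congr 1
      ring
    rw [← h2]
    unfold amplitude
    push_cast
    linear_combination (((n : ℝ) ^ (-(σ / 4)) : ℝ) : ℂ) * (((n : ℝ) ^ (-(σ / 4)) : ℝ) : ℂ) * h3
  rw [← norm_mul, ← norm_mul, h1, Complex.norm_real, Real.norm_of_nonneg (by positivity)]

/-- The defect is `n ^ σ A_n` times the relative defect estimated in `unifBigO_defect`. -/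
theorem defect_eq {n : ℕ} (hn : 1 ≤ n) (k : ℂ) :
    defect a B σ τ L p q n k = (((n : ℝ) ^ σ : ℝ) : ℂ) * amplitude σ τ L p q n k *
      (((a (n - 1) * (n : ℝ) ^ (-σ) * (1 + -1 * (n : ℝ)⁻¹) ^ (-(σ / 4)) : ℝ) : ℂ) *
          Complex.exp (-(Complex.I * phase σ τ L p q n k)) +
        ((a n * (n : ℝ) ^ (-σ) * (1 + 1 * (n : ℝ)⁻¹) ^ (-(σ / 4)) : ℝ) : ℂ) *
          Complex.exp (Complex.I * phase σ τ L p q (n + 1) k) -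
        2 * ((B n * (n : ℝ) ^ (-σ) / 2 : ℝ) : ℂ) + k ^ 2 * (((n : ℝ) ^ (-σ) : ℝ) : ℂ)) := by
  have hn0 : (0 : ℝ) < n := by exact_mod_cast hn
  obtain ⟨m, rfl⟩ : ∃ m, n = m + 1 := ⟨n - 1, by omega⟩
  set ν : ℝ := ((m + 1 : ℕ) : ℝ) with hν
  have hinv : ν ^ σ * ν ^ (-σ) = 1 := by rw [← Real.rpow_add hn0]; simp
  have e1 : ((m : ℕ) : ℝ) ^ (-(σ / 4)) = ν ^ (-(σ / 4)) * (1 + -1 * ν⁻¹) ^ (-(σ / 4)) := by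
    have : 1 + -1 * ν⁻¹ = m / ν := by rw [hν]; push_cast; field_simp; ring
    rw [this, ← Real.mul_rpow hn0.le (by positivity)]
    congr 1
    field_simp
  have e2 : ((m + 1 + 1 : ℕ) : ℝ) ^ (-(σ / 4)) =
      ν ^ (-(σ / 4)) * (1 + 1 * ν⁻¹) ^ (-(σ / 4)) := by
    rw [← Real.mul_rpow hn0.le (by positivity)]
    congr 1
    rw [hν]
    push_cast
    field_simp
  have e3 : Complex.exp (Complex.I * phaseSum σ τ L p q m k) =
      Complex.exp (Complex.I * phaseSum σ τ L p q (m + 1) k) *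
        Complex.exp (-(Complex.I * phase σ τ L p q (m + 1) k)) := by
    rw [phaseSum_succ m, ← Complex.exp_add]
    congr 1
    ring
  have e4 : Complex.exp (Complex.I * phaseSum σ τ L p q (m + 1 + 1) k) =
      Complex.exp (Complex.I * phaseSum σ τ L p q (m + 1) k) *
        Complex.exp (Complex.I * phase σ τ L p q (m + 1 + 1) k) := by
    rw [phaseSum_succ (m + 1), ← Complex.exp_add]
    congr 1
    ring
  have hinv' : ((ν ^ σ : ℝ) : ℂ) * ((ν ^ (-σ) : ℝ) : ℂ) = 1 := by exact_mod_cast hinv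
  unfold defect amplitude
  rw [Nat.add_sub_cancel, e1, e2, e3, e4]
  set x := ((ν ^ (-(σ / 4)) : ℝ) : ℂ) with hx
  set X := Complex.exp (Complex.I * phaseSum σ τ L p q (m + 1) k)
  push_cast
  linear_combination -(x * X) *
    (a m * (((1 + -1 * ν⁻¹) ^ (-(σ / 4)) : ℝ) : ℂ) *
        Complex.exp (-(Complex.I * phase σ τ L p q (m + 1) k)) +
      a (m + 1) * (((1 + 1 * ν⁻¹) ^ (-(σ / 4)) : ℝ) : ℂ) *
        Complex.exp (Complex.I * phase σ τ L p q (m + 1 + 1) k) - B (m + 1) + k ^ 2) * hinv'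

theorem firstOrder_pred_coeff (ha : FirstOrder α (fun n => a n * (n : ℝ) ^ (-σ))) :
    FirstOrder (α - 3 * σ / 4)
      (fun n => a (n - 1) * (n : ℝ) ^ (-σ) * (1 + -1 * (n : ℝ)⁻¹) ^ (-(σ / 4))) := by
  have h := ha.pred.mul (firstOrder_rpow (-1) (3 * σ / 4))
  rw [show α - 3 * σ / 4 = α + 3 * σ / 4 * -1 by ring]
  refine h.congr' ?_
  filter_upwards [eventually_ge_atTop 2] with n hn
  obtain ⟨m, rfl⟩ : ∃ m, n = m + 1 := ⟨n - 1, by omega⟩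
  have hm : (0 : ℝ) < m := by exact_mod_cast (by omega : 0 < m)
  have e : 1 + -1 * ((m + 1 : ℕ) : ℝ)⁻¹ = m * ((m + 1 : ℕ) : ℝ)⁻¹ := by
    push_cast
    field_simp
    ring
  have hpos : (0 : ℝ) < m * ((m + 1 : ℕ) : ℝ)⁻¹ := by positivity
  rw [Nat.add_sub_cancel, e, show 3 * σ / 4 = σ + -(σ / 4) by ring, Real.rpow_add hpos,
    Real.mul_rpow (x := (m : ℝ)) (z := σ) hm.le (by positivity),
    Real.inv_rpow (by positivity), ← Real.rpow_neg (by positivity)]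
  have h1 : (m : ℝ) ^ (-σ) * (m : ℝ) ^ σ = 1 := by rw [← Real.rpow_add hm]; simp
  linear_combination a m * ((m + 1 : ℕ) : ℝ) ^ (-σ) *
    (m * ((m + 1 : ℕ) : ℝ)⁻¹) ^ (-(σ / 4)) * h1

/-! ### Bounds for the Volterra kernel -/

/-- The factor `G_n` in `W_n (E_{n+1} - E_n) = -2 i k G_n`; it tends to `1`. -/
noncomputable def wronskianFactor (a : ℕ → ℝ) (σ τ : ℝ) (L : ℕ) (p : ℕ → ℝ) (q : Polynomial ℂ)
    (n : ℕ) (k : ℂ) : ℂ :=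
  ((a n * (n : ℝ) ^ (-σ) : ℝ) : ℂ) * (((1 + 1 * (n : ℝ)⁻¹) ^ (-(3 * σ / 4)) : ℝ) : ℂ) *
    (q.eval (relCorrection σ τ L p (n + 1) (k ^ 2)) *
      dslope Complex.sin 0 (phase σ τ L p q (n + 1) k))

theorem unifSymbol_wronskianFactor (hr : 0 < r) (hε : SmallExponent σ L ε)
    (hq : q.coeff 0 = 1) (ha : FirstOrder α (fun n => a n * (n : ℝ) ^ (-σ))) :
    UnifSymbol (closedAnnulus r R) (-ε) (fun n k => wronskianFactor a σ τ L p q n k - 1) := by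
  have h0 := hε.pos
  have h2 := hε.two_mul_le
  have h3 := hε.le_one_sub
  have hs := unifSymbol_relCorrection (τ := τ) (p := p) (R := R) hr hε
  have hΘ := unifSymbol_phase (τ := τ) (p := p) (q := q) (R := R) hr hε
  have t1 := (ha.unifSymbol (closedAnnulus r R)).mono (e₂ := -ε) (by linarith)
  have t2 := ((firstOrder_rpow 1 (-(3 * σ / 4))).unifSymbol (closedAnnulus r R)).mono
    (e₂ := -ε) (by linarith)
  have t3 := (unifSymbol_eval_sub_one hq hs (by linarith)).shift
  have hd : Differentiable ℂ (dslope Complex.sin 0) := by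
    rw [← differentiableOn_univ, Complex.differentiableOn_dslope univ_mem]
    exact Complex.differentiable_sin.differentiableOn
  have hsd : HasStrictDerivAt (dslope Complex.sin 0) (deriv (dslope Complex.sin 0) 0) 0 :=
    (hd.analyticAt 0).hasStrictDerivAt
  have t4 := ((hΘ.comp_sub hsd (by linarith)).shift).mono (e₂ := -ε) (by linarith)
  rw [dslope_same, Complex.deriv_sin, Complex.cos_zero] at t4
  exact (t1.mul_sub_one t2 (by linarith)).mul_sub_one (t3.mul_sub_one t4 (by linarith))
    (by linarith)

/-- The exact identity behind the summation by parts: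
`E_{n+1} - E_n` is `-2 i sin Θ_{n+1}` divided by the exponential factors in `A_n A_{n+1}`. -/
theorem wronskian_mul_expFactor_sub {n : ℕ} (hn : 1 ≤ n) (k : ℂ) :
    a n * amplitude σ τ L p q n k * amplitude σ τ L p q (n + 1) k *
      (expFactor σ τ L p q (n + 1) k - expFactor σ τ L p q n k) =
      -(2 * Complex.I * k) * wronskianFactor a σ τ L p q n k := by
  have hn0 : (0 : ℝ) < n := by exact_mod_cast hn
  set x := Complex.exp (Complex.I * phaseSum σ τ L p q n k) with hx
  set y := Complex.exp (Complex.I * phase σ τ L p q (n + 1) k) with hy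
  have hx0 : x ≠ 0 := Complex.exp_ne_zero _
  have hy0 : y ≠ 0 := Complex.exp_ne_zero _
  have e1 : Complex.exp (Complex.I * phaseSum σ τ L p q (n + 1) k) = x * y := by
    rw [phaseSum_succ, mul_add, Complex.exp_add]
  have hE : ∀ z : ℂ, Complex.exp (-(2 * z)) = (Complex.exp z ^ 2)⁻¹ := by
    intro z
    rw [Complex.exp_neg, two_mul, Complex.exp_add, pow_two]
  have hsin : phase σ τ L p q (n + 1) k * dslope Complex.sin 0 (phase σ τ L p q (n + 1) k) =
      (y⁻¹ - y) * Complex.I / 2 := by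
    have := sub_smul_dslope Complex.sin 0 (phase σ τ L p q (n + 1) k)
    rw [sub_zero, smul_eq_mul, Complex.sin_zero, sub_zero] at this
    rw [this, Complex.sin, hy, ← Complex.exp_neg]
    ring_nf
  have hpow : (n : ℝ) ^ (-(σ / 4)) * ((n + 1 : ℕ) : ℝ) ^ (-(σ / 4)) *
      ((n + 1 : ℕ) : ℝ) ^ (-(σ / 2)) =
      (n : ℝ) ^ (-σ) * (1 + 1 * (n : ℝ)⁻¹) ^ (-(3 * σ / 4)) := by
    have e : 1 + 1 * (n : ℝ)⁻¹ = ((n + 1 : ℕ) : ℝ) * (n : ℝ)⁻¹ := by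
      push_cast
      field_simp
    have hn1 : (0 : ℝ) < ((n + 1 : ℕ) : ℝ) := by positivity
    rw [e, Real.mul_rpow hn1.le (by positivity), Real.inv_rpow hn0.le, ← Real.rpow_neg hn0.le,
      mul_assoc, ← Real.rpow_add hn1, mul_left_comm, ← Real.rpow_add hn0, mul_comm]
    congr 2 <;> ring
  have hpow' : (((n : ℝ) ^ (-(σ / 4)) : ℝ) : ℂ) * ((((n + 1 : ℕ) : ℝ) ^ (-(σ / 4)) : ℝ) : ℂ) *
      ((((n + 1 : ℕ) : ℝ) ^ (-(σ / 2)) : ℝ) : ℂ) =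
      (((n : ℝ) ^ (-σ) : ℝ) : ℂ) * (((1 + 1 * (n : ℝ)⁻¹) ^ (-(3 * σ / 4)) : ℝ) : ℂ) := by
    exact_mod_cast hpow
  unfold amplitude expFactor wronskianFactor
  rw [hE, hE, e1, ← hx]
  set d := dslope Complex.sin 0 (phase σ τ L p q (n + 1) k)
  rw [phase] at hsin
  set Q := q.eval (relCorrection σ τ L p (n + 1) (k ^ 2))
  set P₁ := (((n : ℝ) ^ (-(σ / 4)) : ℝ) : ℂ)
  set P₂ := ((((n + 1 : ℕ) : ℝ) ^ (-(σ / 4)) : ℝ) : ℂ)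
  set P₃ := ((((n + 1 : ℕ) : ℝ) ^ (-(σ / 2)) : ℝ) : ℂ)
  have h1 : a n * (P₁ * x) * (P₂ * (x * y)) * (((x * y) ^ 2)⁻¹ - (x ^ 2)⁻¹) =
      a n * P₁ * P₂ * (y⁻¹ - y) := by
    field_simp
  have h2 : y⁻¹ - y = -(2 * Complex.I) * (k * P₃ * Q * d) := by
    rw [hsin]
    linear_combination (y⁻¹ - y) * Complex.I_sq
  rw [h1, h2, Complex.ofReal_mul]
  linear_combination -(2 * Complex.I) * a n * k * Q * d * hpow'

/-- The imaginary parts of the phases are nonnegative up to the summable error `g`, so `‖E_j‖` is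
nondecreasing up to a constant factor. -/
theorem norm_expFactor_le {N : ℕ} {k : ℂ} {g : ℕ → ℝ} {G : ℝ}
    (hg : ∀ n, N ≤ n → -g n ≤ (phase σ τ L p q n k).im)
    (hsum : ∀ j m, N ≤ j → ∑ i ∈ Finset.Ico (j + 1) (m + 1), g i ≤ G) {j m : ℕ} (hj : N ≤ j)
    (hm : j ≤ m) :
    ‖expFactor σ τ L p q j k‖ ≤ Real.exp (2 * G) * ‖expFactor σ τ L p q m k‖ := by
  have hnorm : ∀ n, ‖expFactor σ τ L p q n k‖ = Real.exp (2 * (phaseSum σ τ L p q n k).im) := by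
    intro n
    rw [expFactor, Complex.norm_exp]
    congr 1
    simp
  have h : (phaseSum σ τ L p q j k).im ≤
      (phaseSum σ τ L p q m k).im + ∑ i ∈ Finset.Ico (j + 1) (m + 1), g i := by
    induction m, hm using Nat.le_induction with
    | base => simp
    | succ m hm ih =>
      rw [phaseSum_succ, Finset.sum_Ico_succ_top (by omega), Complex.add_im]
      linarith [hg (m + 1) (by omega)]
  rw [hnorm, hnorm, ← Real.exp_add, Real.exp_le_exp]
  linarith [hsum j m hj]

/-- On an annulus, the Volterra equation for the ratio of a solution to the ansatz is uniformly
controlled by a summable majorant `g` with tails `t`. -/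
theorem exists_volterraBounds (hσ0 : 0 < σ) (hσ1 : σ ≤ 1) (hr : 0 < r)
    (hε : SmallExponent σ L ε) (hp : IsEikonal L p) (hq : q.coeff 0 = 1) {K : ℕ}
    (hK : 2 ≤ (K + 1) * ε)
    (hqK : (Polynomial.X : Polynomial ℂ) ^ (K + 1) ∣ q ^ 2 - (1 + Polynomial.X))
    (hτ : τ = 2 * β - 2 * α + σ) (ha : FirstOrder α (fun n => a n * (n : ℝ) ^ (-σ)))
    (hB : FirstOrder β (fun n => B n * (n : ℝ) ^ (-σ) / 2)) :
    ∃ (N : ℕ) (C : ℝ) (g t : ℕ → ℝ), 1 ≤ N ∧ Tendsto t atTop (𝓝 0) ∧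
      ∀ k ∈ closedAnnulus r R, 0 ≤ k.im →
        VolterraBounds N C g t
          (fun n => a n * amplitude σ τ L p q n k * amplitude σ τ L p q (n + 1) k)
          (fun n => (-(2 * Complex.I * k) * wronskianFactor a σ τ L p q n k)⁻¹)
          (fun n => expFactor σ τ L p q n k)
          (fun n => amplitude σ τ L p q n k * defect a B σ τ L p q n k) := by
  have h0 := hε.pos
  obtain ⟨C₁, hC₁, hdef⟩ := unifBigO_iff.1 (unifBigO_defect (R := R) hp hσ1 hr hε hq hK hqK hτ
    (firstOrder_pred_coeff ha) (ha.mul (firstOrder_rpow 1 (-(σ / 4))) |>.congr'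
      (Eventually.of_forall fun n => rfl) |> fun h => by
        rwa [show α + -(σ / 4) * 1 = α - σ / 4 by ring] at h) hB)
  have hw := unifSymbol_wronskianFactor (τ := τ) (p := p) (R := R) hr hε hq ha
  have hw1 := hw.1.eventually_le (by linarith) (δ := 1 / 2) (by norm_num)
  obtain ⟨C₂, hC₂, hw2⟩ := unifBigO_iff.1 hw.2
  obtain ⟨C₃, hC₃, hloc⟩ := unifBigO_iff.1
    (unifBigO_phase_sub_localPhase (τ := τ) (p := p) (R := R) hr hσ0 hε hq hK hqK)
  have him := eventually_localPhase_im_nonneg (τ := τ) (p := p) (R := R) hσ0 hσ1 hr hε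
  set C₀ := C₁ + 2 * C₂ / r + C₃ with hC₀
  have hC₀1 : C₁ ≤ C₀ := by
    have : 0 ≤ 2 * C₂ / r := by positivity
    linarith
  have hC₀2 : 2 * C₂ / r ≤ C₀ := by linarith
  have hC₀3 : C₃ ≤ C₀ := by
    have : 0 ≤ 2 * C₂ / r := by positivity
    linarith
  set g : ℕ → ℝ := fun n => C₀ * (n : ℝ) ^ (-1 - ε) with hg
  have hg0 : ∀ n, 0 ≤ g n := fun n => mul_nonneg (hC₁.trans hC₀1) (by positivity)
  have hgs : Summable g := (Real.summable_nat_rpow.2 (by linarith)).mul_left C₀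
  set t : ℕ → ℝ := fun n => ∑' i, g (i + n) with ht
  have ht0 : Tendsto t atTop (𝓝 0) := tendsto_sum_nat_add g
  have hsum : ∀ n M, ∑ j ∈ Finset.Ico n M, g j ≤ t n := by
    intro n M
    rw [Finset.sum_Ico_eq_sum_range]
    simp only [add_comm n]
    exact ((summable_nat_add_iff n).2 hgs).sum_le_tsum _ fun i _ => hg0 _
  set C := 1 / r + Real.exp 2 with hC
  have hCr : 1 / r ≤ C := by linarith [Real.exp_pos 2]
  have hCe : Real.exp 2 ≤ C := by
    have : 0 < 1 / r := by positivity
    linarith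
  have hC0 : 0 ≤ C := (Real.exp_pos 2).le.trans hCe
  have hsmall : ∀ᶠ n in atTop, C * (2 + C) * t n ≤ 1 / 2 := by
    have : Tendsto (fun n => C * (2 + C) * t n) atTop (𝓝 0) := by
      simpa using ht0.const_mul (C * (2 + C))
    exact this.eventually (ge_mem_nhds (by norm_num))
  obtain ⟨N, hN⟩ := eventually_atTop.1 (hdef.and (hw1.and (hw2.and (hloc.and (him.and
    (eventually_ge_atTop 1))))))
  obtain ⟨N', hN', hNN', hN'2⟩ : ∃ N', N ≤ N' ∧ C * (2 + C) * t N' ≤ 1 / 2 ∧ t N' ≤ 1 := by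
    obtain ⟨N', h⟩ := ((eventually_ge_atTop N).and (hsmall.and
      (ht0.eventually (ge_mem_nhds one_pos)))).exists
    exact ⟨N', h⟩
  have hpow2 : ∀ n : ℕ, 1 ≤ n → C₃ * (n : ℝ) ^ (-2 : ℝ) ≤ g n := by
    intro n hn
    have : (1 : ℝ) ≤ n := by exact_mod_cast hn
    refine mul_le_mul hC₀3 (Real.rpow_le_rpow_of_exponent_le this ?_) (by positivity)
      (hC₁.trans hC₀1)
    linarith [hε.le_one_sub]
  refine ⟨N', C, g, t, ((hN N le_rfl).2.2.2.2.2).trans hN', ht0, fun k hk hkim => ?_⟩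
  have hk0 : k ≠ 0 := norm_pos_iff.1 (hr.trans_le hk.1)
  have hGnorm : ∀ n, N' ≤ n → 1 / 2 ≤ ‖wronskianFactor a σ τ L p q n k‖ := by
    intro n hn
    have h1 := (hN n (hN'.trans hn)).2.1 k hk
    have h2 := norm_sub_norm_le (1 : ℂ) (1 - wronskianFactor a σ τ L p q n k)
    rw [sub_sub_cancel, norm_sub_rev, norm_one] at h2
    linarith
  have hdenom : ∀ n, N' ≤ n →
      r ≤ ‖-(2 * Complex.I * k) * wronskianFactor a σ τ L p q n k‖ := by
    intro n hn
    have h1 := hGnorm n hn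
    have h2 : ‖-(2 * Complex.I * k) * wronskianFactor a σ τ L p q n k‖ =
        2 * ‖k‖ * ‖wronskianFactor a σ τ L p q n k‖ := by simp
    rw [h2]
    nlinarith [hk.1, norm_nonneg k]
  have hWE : ∀ n, N' ≤ n → a n * amplitude σ τ L p q n k * amplitude σ τ L p q (n + 1) k *
      (expFactor σ τ L p q (n + 1) k - expFactor σ τ L p q n k) =
      -(2 * Complex.I * k) * wronskianFactor a σ τ L p q n k := fun n hn =>
    wronskian_mul_expFactor_sub (hN n (hN'.trans hn)).2.2.2.2.2 k
  have hne : ∀ n, N' ≤ n → -(2 * Complex.I * k) * wronskianFactor a σ τ L p q n k ≠ 0 :=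
    fun n hn => norm_pos_iff.1 (hr.trans_le (hdenom n hn))
  have hWne : ∀ n, N' ≤ n →
      (a n : ℂ) * amplitude σ τ L p q n k * amplitude σ τ L p q (n + 1) k ≠ 0 := fun n hn =>
    left_ne_zero_of_mul ((hWE n hn).trans_ne (hne n hn))
  have hphase : ∀ n, N' ≤ n → -g n ≤ (phase σ τ L p q n k).im := by
    intro n hn
    obtain ⟨-, -, -, h1, h2, h3⟩ := hN n (hN'.trans hn)
    have h4 := (abs_le.1 ((Complex.abs_im_le_norm _).trans (h1 k hk))).1
    rw [Complex.sub_im] at h4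
    linarith [h2 k hk hkim, hpow2 n h3]
  refine ⟨hC0, hg0, hsum, hNN', hN'2, hWne, fun n hn => ?_, fun n hn => ?_, fun n hn => ?_,
    fun j m hj hm => ?_, fun n hn => ?_⟩
  · have h1 := hWne n hn
    have h2 := hWE n hn
    rw [← h2]
    have h3 := right_ne_zero_of_mul (h2.trans_ne (hne n hn))
    field_simp
  · rw [norm_inv, ← one_div]
    exact (one_div_le_one_div_of_le hr (hdenom n hn)).trans hCr
  · obtain ⟨-, -, h1, -, -, h3⟩ := hN n (hN'.trans hn)
    have h4 := h1 k hk
    rw [sub_sub_sub_cancel_right] at h4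
    rw [inv_sub_inv (hne _ (by omega)) (hne n hn), norm_div, norm_mul, ← mul_sub, norm_mul,
      div_le_iff₀ (mul_pos (hr.trans_le (hdenom _ (by omega))) (hr.trans_le (hdenom n hn)))]
    have h5 := hGnorm n hn
    have h6 : ‖-(2 * Complex.I * k) * wronskianFactor a σ τ L p q n k‖ =
        ‖-(2 * Complex.I * k)‖ * ‖wronskianFactor a σ τ L p q n k‖ := norm_mul _ _
    have h7 := hdenom (n + 1) (by omega)
    have h8 : ‖wronskianFactor a σ τ L p q n k - wronskianFactor a σ τ L p q (n + 1) k‖ ≤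
        C₂ * (n : ℝ) ^ (-1 - ε) := by
      rw [norm_sub_rev]
      convert h4 using 3
      ring
    have h9 : 0 ≤ (n : ℝ) ^ (-1 - ε) := by positivity
    rw [h6]
    calc _ ≤ ‖-(2 * Complex.I * k)‖ * (C₂ * (n : ℝ) ^ (-1 - ε)) := by gcongr
      _ = (2 * C₂ / r * (n : ℝ) ^ (-1 - ε)) * (r * (‖-(2 * Complex.I * k)‖ * (1 / 2))) := by
          field_simp
      _ ≤ g n * (‖-(2 * Complex.I * k) * wronskianFactor a σ τ L p q (n + 1) k‖ *
            (‖-(2 * Complex.I * k)‖ * ‖wronskianFactor a σ τ L p q n k‖)) := by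
          gcongr
          exact mul_le_mul_of_nonneg_right hC₀2 h9
  · refine (norm_expFactor_le (G := 1) hphase (fun j m hj => ?_) hj hm).trans ?_
    · refine le_trans ?_ ((hsum N' (m + 1)).trans hN'2)
      exact Finset.sum_le_sum_of_subset_of_nonneg (Finset.Ico_subset_Ico_left (by omega))
        fun i _ _ => hg0 i
    · rw [mul_one]
      gcongr
  · obtain ⟨h1, -, -, -, -, h3⟩ := hN n (hN'.trans hn)
    have hn0 : (0 : ℝ) < n := by exact_mod_cast h3
    rw [defect_eq h3, norm_mul, norm_mul, norm_mul, Complex.norm_real,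
      Real.norm_of_nonneg (by positivity)]
    have h4 := norm_amplitude_sq_mul (σ := σ) (τ := τ) (L := L) (p := p) (q := q) n h3 k
    have h5 := h1 k hk
    generalize ((a (n - 1) * (n : ℝ) ^ (-σ) * (1 + -1 * (n : ℝ)⁻¹) ^ (-(σ / 4)) : ℝ) : ℂ) *
      Complex.exp (-(Complex.I * phase σ τ L p q n k)) + _ - _ + _ = D at h5 ⊢
    have h6 : (n : ℝ) ^ (-(σ / 2)) * (n : ℝ) ^ σ * (n : ℝ) ^ (-(σ / 2) - 1 - ε) =
        (n : ℝ) ^ (-1 - ε) := by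
      rw [← Real.rpow_add hn0, ← Real.rpow_add hn0]
      congr 1
      ring
    calc _ = (‖amplitude σ τ L p q n k‖ * ‖amplitude σ τ L p q n k‖ *
          ‖expFactor σ τ L p q n k‖) * (n : ℝ) ^ σ * ‖D‖ := by ring
      _ ≤ (n : ℝ) ^ (-(σ / 2)) * (n : ℝ) ^ σ * (C₁ * (n : ℝ) ^ (-(σ / 2) - 1 - ε)) := by
          rw [h4]
          exact mul_le_mul_of_nonneg_left h5 (by positivity)
      _ = C₁ * (n : ℝ) ^ (-1 - ε) := by rw [← h6]; ring
      _ ≤ g n := mul_le_mul_of_nonneg_right hC₀1 (by positivity)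

end

/-! ### Solutions of the Jacobi recurrence -/

section

/-- The solution of `a n * u n + a (n + 1) * u (n + 2) = (B (n + 1) - w) * u (n + 1)` with initial
values `x₀`, `x₁`. -/
noncomputable def recSol (a B : ℕ → ℝ) (w x₀ x₁ : ℂ) : ℕ → ℂ
  | 0 => x₀
  | 1 => x₁
  | n + 2 => ((B (n + 1) - w) * recSol a B w x₀ x₁ (n + 1) - a n * recSol a B w x₀ x₁ n) / a (n + 1)

variable {a B : ℕ → ℝ} {w : ℂ}

theorem recSol_rec (ha : ∀ n, 0 < a n) (x₀ x₁ : ℂ) (n : ℕ) :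
    a n * recSol a B w x₀ x₁ n + a (n + 1) * recSol a B w x₀ x₁ (n + 2) =
      (B (n + 1) - w) * recSol a B w x₀ x₁ (n + 1) := by
  have h : (a (n + 1) : ℂ) ≠ 0 := Complex.ofReal_ne_zero.2 (ha _).ne'
  rw [recSol]
  field_simp
  ring

theorem recSol_linear (x₀ x₁ : ℂ) (n : ℕ) :
    recSol a B w x₀ x₁ n = x₀ * recSol a B w 1 0 n + x₁ * recSol a B w 0 1 n := by
  induction n using Nat.strong_induction_on with
  | _ n ih =>
    match n, ih with
    | 0, _ => simp [recSol]
    | 1, _ => simp [recSol]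
    | n + 2, ih =>
      rw [recSol, recSol, recSol, ih n (by omega), ih (n + 1) (by omega)]
      ring

/-- The Wronskian of two solutions is constant. -/
theorem wronskian_const {u v : ℕ → ℂ}
    (hu : ∀ n, a n * u n + a (n + 1) * u (n + 2) = (B (n + 1) - w) * u (n + 1))
    (hv : ∀ n, a n * v n + a (n + 1) * v (n + 2) = (B (n + 1) - w) * v (n + 1)) (n : ℕ) :
    a n * (u n * v (n + 1) - u (n + 1) * v n) = a 0 * (u 0 * v 1 - u 1 * v 0) := by
  induction n with
  | zero => rfl
  | succ n ih =>
    rw [← ih]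
    linear_combination u (n + 1) * hv n - v (n + 1) * hu n

/-- The initial values of the solution with the values `x`, `y` at `M`, `M + 1`. -/
noncomputable def initialValues (a B : ℕ → ℝ) (w : ℂ) (M : ℕ) (x y : ℂ) : ℂ × ℂ :=
  (a M * (x * recSol a B w 0 1 (M + 1) - y * recSol a B w 0 1 M) / a 0,
    -(a M * (x * recSol a B w 1 0 (M + 1) - y * recSol a B w 1 0 M)) / a 0)

theorem recSol_initialValues (ha : ∀ n, 0 < a n) (M : ℕ) (x y : ℂ) :
    recSol a B w (initialValues a B w M x y).1 (initialValues a B w M x y).2 M = x ∧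
      recSol a B w (initialValues a B w M x y).1 (initialValues a B w M x y).2 (M + 1) = y := by
  have h0 : (a 0 : ℂ) ≠ 0 := Complex.ofReal_ne_zero.2 (ha _).ne'
  have hW := wronskian_const (recSol_rec (B := B) (w := w) ha 1 0) (recSol_rec ha 0 1) M
  simp only [recSol, mul_zero, sub_zero, mul_one] at hW
  rw [recSol_linear, recSol_linear _ _ (M + 1)]
  constructor
  · simp only [initialValues]
    field_simp
    linear_combination x * hW
  · simp only [initialValues]
    field_simp
    linear_combination y * hW

theorem initialValues_of_sol {u : ℕ → ℂ} (ha : ∀ n, 0 < a n)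
    (hu : ∀ n, a n * u n + a (n + 1) * u (n + 2) = (B (n + 1) - w) * u (n + 1)) (M : ℕ) :
    initialValues a B w M (u M) (u (M + 1)) = (u 0, u 1) := by
  have h0 : (a 0 : ℂ) ≠ 0 := Complex.ofReal_ne_zero.2 (ha _).ne'
  have h1 := wronskian_const hu (recSol_rec ha 0 1) M
  have h2 := wronskian_const hu (recSol_rec ha 1 0) M
  simp only [recSol, mul_zero, sub_zero, mul_one, zero_sub] at h1 h2
  unfold initialValues
  rw [h1, h2]
  ext <;> field_simp

theorem differentiable_recSol (x₀ x₁ : ℂ) (n : ℕ) :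
    Differentiable ℂ (fun k : ℂ => recSol a B (k ^ 2) x₀ x₁ n) := by
  induction n using Nat.strong_induction_on with
  | _ n ih =>
    match n, ih with
    | 0, _ => simp only [recSol]; fun_prop
    | 1, _ => simp only [recSol]; fun_prop
    | n + 2, ih =>
      have h1 := ih n (by omega)
      have h2 := ih (n + 1) (by omega)
      simp only [recSol]
      fun_prop

/-! ### The Jost solution -/

section Jost

variable (a B) (σ τ : ℝ) (L : ℕ) (p : ℕ → ℝ) (q : Polynomial ℂ)

/-- The initial values of the solution that is equal to the ansatz at `M` and `M + 1`. -/
noncomputable def approxInit (M : ℕ) (k : ℂ) : ℂ × ℂ :=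
  initialValues a B (k ^ 2) M (amplitude σ τ L p q M k) (amplitude σ τ L p q (M + 1) k)

/-- The solution that is equal to the ansatz at `M` and `M + 1`. -/
noncomputable def approxSol (M n : ℕ) (k : ℂ) : ℂ :=
  recSol a B (k ^ 2) (approxInit a B σ τ L p q M k).1 (approxInit a B σ τ L p q M k).2 n

/-- The Jost solution, the limit of `approxSol` as `M → ∞`. -/
noncomputable def jost (n : ℕ) (k : ℂ) : ℂ :=
  recSol a B (k ^ 2) (limUnder atTop fun M => (approxInit a B σ τ L p q M k).1)
    (limUnder atTop fun M => (approxInit a B σ τ L p q M k).2) n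

end Jost

variable {σ τ : ℝ} {L : ℕ} {p : ℕ → ℝ} {q : Polynomial ℂ} {ε r R α β : ℝ}

theorem terminalSolution_approxSol (ha : ∀ n, 0 < a n) {N M : ℕ} (hN : 1 ≤ N) (hM : N ≤ M)
    (k : ℂ) :
    TerminalSolution N M
      (fun n => a n * amplitude σ τ L p q n k * amplitude σ τ L p q (n + 1) k)
      (fun n => amplitude σ τ L p q n k * defect a B σ τ L p q n k)
      (fun n => approxSol a B σ τ L p q M n k / amplitude σ τ L p q n k) := by
  obtain ⟨h1, h2⟩ := recSol_initialValues (B := B) (w := k ^ 2) ha M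
    (amplitude σ τ L p q M k) (amplitude σ τ L p q (M + 1) k)
  refine ⟨fun n hn => ?_, ?_, ?_⟩
  · have hrec : a n * approxSol a B σ τ L p q M n k +
        a (n + 1) * approxSol a B σ τ L p q M (n + 2) k =
        (B (n + 1) - k ^ 2) * approxSol a B σ τ L p q M (n + 1) k := recSol_rec ha _ _ n
    have e0 := amplitude_ne_zero (σ := σ) (τ := τ) (L := L) (p := p) (q := q)
      (n := n) (by omega) k
    have e1 := amplitude_ne_zero (σ := σ) (τ := τ) (L := L) (p := p) (q := q)
      (n := n + 1) (by omega) k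
    have e2 := amplitude_ne_zero (σ := σ) (τ := τ) (L := L) (p := p) (q := q)
      (n := n + 2) (by omega) k
    simp only [defect, Nat.add_sub_cancel, add_assoc, one_add_one_eq_two]
    field_simp
    linear_combination amplitude σ τ L p q (n + 1) k * hrec
  · rw [show approxSol a B σ τ L p q M M k = amplitude σ τ L p q M k from h1]
    exact div_self (amplitude_ne_zero (by omega) k)
  · rw [show approxSol a B σ τ L p q M (M + 1) k = amplitude σ τ L p q (M + 1) k from h2]
    exact div_self (amplitude_ne_zero (by omega) k)

theorem isCompact_closedAnnulus (r R : ℝ) : IsCompact (closedAnnulus r R) := by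
  refine (isCompact_closedBall (0 : ℂ) R).of_isClosed_subset ?_ fun k hk => ?_
  · exact (isClosed_le continuous_const continuous_norm).inter
      (isClosed_le continuous_norm continuous_const)
  · simpa using hk.2

/-- The intersection of an annulus with the closed upper half-plane. -/
def upperAnnulus (r R : ℝ) : Set ℂ := closedAnnulus r R ∩ {k | 0 ≤ k.im}

/-- The properties of the approximate solutions from which those of the Jost solution follow. -/
structure HasJostLimit (a B : ℕ → ℝ) (σ τ : ℝ) (L : ℕ) (p : ℕ → ℝ) (q : Polynomial ℂ)
    (S : Set ℂ) : Prop where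
  fst_lim : TendstoUniformlyOn (fun M k => (approxInit a B σ τ L p q M k).1)
    (fun k => limUnder atTop fun M => (approxInit a B σ τ L p q M k).1) atTop S
  snd_lim : TendstoUniformlyOn (fun M k => (approxInit a B σ τ L p q M k).2)
    (fun k => limUnder atTop fun M => (approxInit a B σ τ L p q M k).2) atTop S
  asymp : ∀ k ∈ S, Tendsto (fun n => jost a B σ τ L p q n k / amplitude σ τ L p q n k) atTop (𝓝 1)

/-- A sequence of functions with `‖f M - f M'‖ ≤ t M` for `M ≤ M'` and `t M → 0` converges
uniformly. -/
theorem tendstoUniformlyOn_limUnder {f : ℕ → ℂ → ℂ} {S : Set ℂ} {t : ℕ → ℝ} {N : ℕ}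
    (ht : Tendsto t atTop (𝓝 0))
    (h : ∀ k ∈ S, ∀ M M', N ≤ M → M ≤ M' → ‖f M k - f M' k‖ ≤ t M) :
    TendstoUniformlyOn f (fun k => limUnder atTop fun M => f M k) atTop S := by
  have hU : UniformCauchySeqOn f atTop S := by
    rw [Metric.uniformCauchySeqOn_iff]
    intro δ hδ
    obtain ⟨N₁, hN₁⟩ := eventually_atTop.1 (ht.eventually (gt_mem_nhds (half_pos hδ)))
    have key : ∀ M, max N N₁ ≤ M → ∀ k ∈ S, ‖f (max N N₁) k - f M k‖ < δ / 2 :=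
      fun M hM k hk => (h k hk _ _ (le_max_left _ _) hM).trans_lt (hN₁ _ (le_max_right _ _))
    refine ⟨max N N₁, fun m hm n hn k hk => ?_⟩
    have h1 := key m hm k hk
    have h2 := key n hn k hk
    rw [← dist_eq_norm] at h1 h2
    linarith [dist_triangle_left (f m k) (f n k) (f (max N N₁) k)]
  exact hU.tendstoUniformlyOn_of_tendsto fun k hk => (hU.cauchySeq hk).tendsto_limUnder

/-- The initial values can be read off from the solution at any fixed `n`; convergence for one large
`n` therefore gives convergence of the initial values, and so of the solution everywhere. -/
theorem approxInit_eq (ha : ∀ n, 0 < a n) (M n : ℕ) (k : ℂ) :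
    approxInit a B σ τ L p q M k = initialValues a B (k ^ 2) n
      (approxSol a B σ τ L p q M n k) (approxSol a B σ τ L p q M (n + 1) k) := by
  rw [initialValues_of_sol (u := fun n => approxSol a B σ τ L p q M n k) ha
    (recSol_rec ha _ _) n]
  rfl

theorem tendsto_jost {k : ℂ}
    (h1 : Tendsto (fun M => (approxInit a B σ τ L p q M k).1) atTop
      (𝓝 (limUnder atTop fun M => (approxInit a B σ τ L p q M k).1)))
    (h2 : Tendsto (fun M => (approxInit a B σ τ L p q M k).2) atTop
      (𝓝 (limUnder atTop fun M => (approxInit a B σ τ L p q M k).2))) (n : ℕ) :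
    Tendsto (fun M => approxSol a B σ τ L p q M n k) atTop (𝓝 (jost a B σ τ L p q n k)) := by
  rw [show jost a B σ τ L p q n k = _ from recSol_linear _ _ n]
  exact ((h1.mul_const _).add (h2.mul_const _)).congr fun M => (recSol_linear _ _ n).symm

theorem hasJostLimit (ha0 : ∀ n, 0 < a n) (hσ0 : 0 < σ) (hσ1 : σ ≤ 1) (hr : 0 < r)
    (hε : SmallExponent σ L ε) (hp : IsEikonal L p) (hq : q.coeff 0 = 1) {K : ℕ}
    (hK : 2 ≤ (K + 1) * ε)
    (hqK : (Polynomial.X : Polynomial ℂ) ^ (K + 1) ∣ q ^ 2 - (1 + Polynomial.X))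
    (hτ : τ = 2 * β - 2 * α + σ) (ha : FirstOrder α (fun n => a n * (n : ℝ) ^ (-σ)))
    (hB : FirstOrder β (fun n => B n * (n : ℝ) ^ (-σ) / 2)) :
    HasJostLimit a B σ τ L p q (upperAnnulus r R) := by
  obtain ⟨N, C, g, t, hN, ht, hb⟩ := exists_volterraBounds (a := a) (B := B) (τ := τ) (R := R)
    hσ0 hσ1 hr hε hp hq hK hqK hτ ha hB
  -- A bound on the annulus for the coefficients that express the initial values in terms of the
  -- ratio `u n / A n` at `n = N` and `n = N + 1`.
  have hbd : ∀ x₀ x₁ : ℂ, ∀ i j : ℕ, ∃ D, 0 ≤ D ∧ ∀ k ∈ closedAnnulus r R,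
      ‖amplitude σ τ L p q i k * recSol a B (k ^ 2) x₀ x₁ j‖ ≤ D := by
    intro x₀ x₁ i j
    obtain ⟨D, hD⟩ := (isCompact_closedAnnulus r R).exists_bound_of_continuousOn
      (f := fun k => amplitude σ τ L p q i k * recSol a B (k ^ 2) x₀ x₁ j) fun k hk =>
        ((differentiableAt_amplitude i (norm_pos_iff.1 (hr.trans_le hk.1))).continuousAt.mul
          (differentiable_recSol x₀ x₁ j).continuous.continuousAt).continuousWithinAt
    exact ⟨max D 0, le_max_right _ _, fun k hk => (hD k hk).trans (le_max_left _ _)⟩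
  have hcauchy : ∀ x₀ x₁ : ℂ, ∃ D, 0 ≤ D ∧ ∀ k ∈ upperAnnulus r R, ∀ M M', N + 1 ≤ M → M ≤ M' →
      ‖a N * (approxSol a B σ τ L p q M N k * recSol a B (k ^ 2) x₀ x₁ (N + 1) -
          approxSol a B σ τ L p q M (N + 1) k * recSol a B (k ^ 2) x₀ x₁ N) / a 0 -
        a N * (approxSol a B σ τ L p q M' N k * recSol a B (k ^ 2) x₀ x₁ (N + 1) -
          approxSol a B σ τ L p q M' (N + 1) k * recSol a B (k ^ 2) x₀ x₁ N) / a 0‖ ≤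
        D * t M := by
    intro x₀ x₁
    obtain ⟨D₁, hD₁, hD₁'⟩ := hbd x₀ x₁ N (N + 1)
    obtain ⟨D₂, hD₂, hD₂'⟩ := hbd x₀ x₁ (N + 1) N
    have hN0 := ha0 N
    have h00 := ha0 0
    -- A point of the annulus is needed only to see that `C ≥ 0`.
    by_cases hne : (upperAnnulus r R).Nonempty
    swap
    · exact ⟨0, le_rfl, fun k hk => absurd ⟨k, hk⟩ hne⟩
    obtain ⟨k₀, hk₀⟩ := hne
    have hC0 := (hb k₀ hk₀.1 hk₀.2).C_nonneg
    refine ⟨a N * (4 * (C * (2 + C))) * (D₁ + D₂) / a 0, by positivity,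
      fun k hk M M' hM hMM => ?_⟩
    have hbk := hb k hk.1 hk.2
    have hM1 := terminalSolution_approxSol (B := B) (σ := σ) (τ := τ) (L := L) (p := p) (q := q)
      ha0 hN (show N ≤ M by omega) k
    have hM2 := terminalSolution_approxSol (B := B) (σ := σ) (τ := τ) (L := L) (p := p) (q := q)
      ha0 hN (show N ≤ M' by omega) k
    have d1 := hbk.norm_sub_le hM1 hM2 hMM le_rfl (by omega)
    have d2 := hbk.norm_sub_le hM1 hM2 hMM (n := N + 1) (by omega) (by omega)
    have e0 := amplitude_ne_zero (σ := σ) (τ := τ) (L := L) (p := p) (q := q) hN k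
    have e1 := amplitude_ne_zero (σ := σ) (τ := τ) (L := L) (p := p) (q := q)
      (n := N + 1) (by omega) k
    set y := fun M n => approxSol a B σ τ L p q M n k / amplitude σ τ L p q n k with hy
    have hu : ∀ M, approxSol a B σ τ L p q M N k = amplitude σ τ L p q N k * y M N := fun M => by
      simp only [hy]; field_simp
    have hu' : ∀ M, approxSol a B σ τ L p q M (N + 1) k =
        amplitude σ τ L p q (N + 1) k * y M (N + 1) := fun M => by
      simp only [hy]; field_simp
    have e : a N * (approxSol a B σ τ L p q M N k * recSol a B (k ^ 2) x₀ x₁ (N + 1) -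
          approxSol a B σ τ L p q M (N + 1) k * recSol a B (k ^ 2) x₀ x₁ N) / a 0 -
        a N * (approxSol a B σ τ L p q M' N k * recSol a B (k ^ 2) x₀ x₁ (N + 1) -
          approxSol a B σ τ L p q M' (N + 1) k * recSol a B (k ^ 2) x₀ x₁ N) / a 0 =
        ((a N / a 0 : ℝ) : ℂ) *
          ((amplitude σ τ L p q N k * recSol a B (k ^ 2) x₀ x₁ (N + 1)) * (y M N - y M' N) -
            (amplitude σ τ L p q (N + 1) k * recSol a B (k ^ 2) x₀ x₁ N) *
              (y M (N + 1) - y M' (N + 1))) := by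
      rw [hu, hu, hu', hu']
      push_cast
      ring
    rw [e, norm_mul, Complex.norm_real, Real.norm_of_nonneg (by positivity)]
    have h3 := norm_sub_le
      ((amplitude σ τ L p q N k * recSol a B (k ^ 2) x₀ x₁ (N + 1)) * (y M N - y M' N))
      ((amplitude σ τ L p q (N + 1) k * recSol a B (k ^ 2) x₀ x₁ N) *
              (y M (N + 1) - y M' (N + 1)))
    rw [norm_mul _ (y M N - y M' N), norm_mul _ (y M (N + 1) - y M' (N + 1))] at h3
    have h4 : ‖amplitude σ τ L p q N k * recSol a B (k ^ 2) x₀ x₁ (N + 1)‖ * ‖y M N - y M' N‖ ≤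
        D₁ * (4 * (C * (2 + C)) * t M) := mul_le_mul (hD₁' k hk.1) d1 (norm_nonneg _) hD₁
    have h5 : ‖amplitude σ τ L p q (N + 1) k * recSol a B (k ^ 2) x₀ x₁ N‖ *
        ‖y M (N + 1) - y M' (N + 1)‖ ≤ D₂ * (4 * (C * (2 + C)) * t M) :=
      mul_le_mul (hD₂' k hk.1) d2 (norm_nonneg _) hD₂
    calc _ ≤ a N / a 0 * (D₁ * (4 * (C * (2 + C)) * t M) + D₂ * (4 * (C * (2 + C)) * t M)) := by
          gcongr
          linarith
      _ = _ := by ring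
  have hfst : TendstoUniformlyOn (fun M k => (approxInit a B σ τ L p q M k).1)
      (fun k => limUnder atTop fun M => (approxInit a B σ τ L p q M k).1) atTop
      (upperAnnulus r R) := by
    obtain ⟨D, -, hD⟩ := hcauchy 0 1
    refine tendstoUniformlyOn_limUnder (N := N + 1) (t := fun M => D * t M)
      (by simpa using ht.const_mul D) fun k hk M M' hM hMM => ?_
    rw [approxInit_eq ha0 M N, approxInit_eq ha0 M' N]
    exact hD k hk M M' hM hMM
  have hsnd : TendstoUniformlyOn (fun M k => (approxInit a B σ τ L p q M k).2)
      (fun k => limUnder atTop fun M => (approxInit a B σ τ L p q M k).2) atTop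
      (upperAnnulus r R) := by
    obtain ⟨D, -, hD⟩ := hcauchy 1 0
    refine tendstoUniformlyOn_limUnder (N := N + 1) (t := fun M => D * t M)
      (by simpa using ht.const_mul D) fun k hk M M' hM hMM => ?_
    rw [approxInit_eq ha0 M N, approxInit_eq ha0 M' N]
    simp only [initialValues, neg_div, neg_sub_neg]
    rw [norm_sub_rev]
    exact hD k hk M M' hM hMM
  refine ⟨hfst, hsnd, fun k hk => ?_⟩
  have hbk := hb k hk.1 hk.2
  have hlim := fun n => tendsto_jost (a := a) (B := B) (n := n) (hfst.tendsto_at hk)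
    (hsnd.tendsto_at hk)
  rw [tendsto_iff_norm_sub_tendsto_zero]
  refine squeeze_zero' (Eventually.of_forall fun n => norm_nonneg _) ?_
    (g := fun n => 2 * (C * (2 + C)) * t n) (by simpa using ht.const_mul (2 * (C * (2 + C))))
  filter_upwards [eventually_ge_atTop N] with n hn
  refine le_of_tendsto (((hlim n).div_const _).sub_const 1).norm ?_
  filter_upwards [eventually_ge_atTop n] with M hM
  exact hbk.norm_sub_one_le (terminalSolution_approxSol ha0 hN (hn.trans hM) k) hn hM

theorem differentiableAt_approxInit (M : ℕ) {k : ℂ} (hk : k ≠ 0) :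
    DifferentiableAt ℂ (fun k => (approxInit a B σ τ L p q M k).1) k ∧
      DifferentiableAt ℂ (fun k => (approxInit a B σ τ L p q M k).2) k := by
  have h1 := differentiableAt_amplitude (σ := σ) (τ := τ) (L := L) (p := p) (q := q) M hk
  have h2 := differentiableAt_amplitude (σ := σ) (τ := τ) (L := L) (p := p) (q := q) (M + 1) hk
  have h3 := fun x₀ x₁ n => (differentiable_recSol (a := a) (B := B) x₀ x₁ n).differentiableAt
    (x := k)
  exact ⟨(((h1.mul (h3 0 1 (M + 1))).sub (h2.mul (h3 0 1 M))).const_mul _).div_const _,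
    ((((h1.mul (h3 1 0 (M + 1))).sub (h2.mul (h3 1 0 M))).const_mul _).neg).div_const _⟩

/-- A locally uniform limit, on the closed upper half-plane without `0`, of analytic functions is
analytic inside and continuous up to the boundary. -/
theorem limit_analytic {f : ℕ → ℂ → ℂ} {F : ℂ → ℂ}
    (hf : ∀ M, ∀ k ≠ 0, DifferentiableAt ℂ (f M) k)
    (h : ∀ r R, 0 < r → TendstoUniformlyOn f F atTop (upperAnnulus r R)) :
    DifferentiableOn ℂ F ({0}ᶜ ∩ {k | 0 < k.im}) ∧
      ContinuousOn F ({0}ᶜ ∩ {k | 0 ≤ k.im}) := by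
  have hU : ∀ k : ℂ, k ≠ 0 → {x : ℂ | ‖k‖ / 2 < ‖x‖ ∧ ‖x‖ < 2 * ‖k‖} ∈ 𝓝 k := by
    intro k hk
    have hk' := norm_pos_iff.2 hk
    exact ((isOpen_lt continuous_const continuous_norm).inter
      (isOpen_lt continuous_norm continuous_const)).mem_nhds 
      ⟨by change ‖k‖ / 2 < ‖k‖; linarith, by change ‖k‖ < 2 * ‖k‖; linarith⟩
  constructor
  · have hopen : IsOpen ({0}ᶜ ∩ {k : ℂ | 0 < k.im}) :=
      isOpen_compl_singleton.inter (isOpen_lt continuous_const Complex.continuous_im)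
    refine TendstoLocallyUniformlyOn.differentiableOn (F := f) (φ := atTop) ?_
      (Eventually.of_forall fun M k hk => (hf M k hk.1).differentiableWithinAt) hopen
    rw [tendstoLocallyUniformlyOn_iff_forall_tendsto]
    intro k hk
    have hk' := norm_pos_iff.2 (show k ≠ 0 from hk.1)
    have h1 := h (‖k‖ / 2) (2 * ‖k‖) (by positivity)
    rw [tendstoUniformlyOn_iff_tendsto] at h1
    refine h1.mono_left (prod_mono le_rfl (le_principal_iff.2 ?_))
    filter_upwards [mem_nhdsWithin_of_mem_nhds (hU k hk.1), self_mem_nhdsWithin] with x hx hx2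
    exact ⟨⟨hx.1.le, hx.2.le⟩, le_of_lt (show 0 < x.im from hx2.2)⟩
  · intro k hk
    have hk' := norm_pos_iff.2 (show k ≠ 0 from hk.1)
    have h1 := (h (‖k‖ / 2) (2 * ‖k‖) (by positivity)).continuousOn
      (Frequently.of_forall fun M x hx => (hf M x (norm_pos_iff.1
        ((half_pos hk').trans_le hx.1.1))).continuousAt.continuousWithinAt)
    have h2 := h1 k ⟨⟨by linarith, by linarith⟩, hk.2⟩
    refine h2.mono_of_mem_nhdsWithin ?_
    filter_upwards [mem_nhdsWithin_of_mem_nhds (hU k hk.1), self_mem_nhdsWithin] with x hx hx2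
    exact ⟨⟨hx.1.le, hx.2.le⟩, hx2.2⟩

theorem jost_analytic (h : ∀ r R, 0 < r → HasJostLimit a B σ τ L p q (upperAnnulus r R)) (n : ℕ) :
    DifferentiableOn ℂ (jost a B σ τ L p q n) ({0}ᶜ ∩ {k | 0 < k.im}) ∧
      ContinuousOn (jost a B σ τ L p q n) ({0}ᶜ ∩ {k | 0 ≤ k.im}) := by
  obtain ⟨d1, c1⟩ := limit_analytic
    (fun M k hk => (differentiableAt_approxInit (a := a) (B := B) (σ := σ) (τ := τ) (L := L)
      (p := p) (q := q) M hk).1) fun r R hr => (h r R hr).fst_lim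
  obtain ⟨d2, c2⟩ := limit_analytic
    (fun M k hk => (differentiableAt_approxInit (a := a) (B := B) (σ := σ) (τ := τ) (L := L)
      (p := p) (q := q) M hk).2) fun r R hr => (h r R hr).snd_lim
  have e : jost a B σ τ L p q n = fun k =>
      (limUnder atTop fun M => (approxInit a B σ τ L p q M k).1) * recSol a B (k ^ 2) 1 0 n +
        (limUnder atTop fun M => (approxInit a B σ τ L p q M k).2) *
          recSol a B (k ^ 2) 0 1 n := by
    funext k
    rw [jost, recSol_linear]
  have hP := fun x₀ x₁ => differentiable_recSol (a := a) (B := B) x₀ x₁ n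
  rw [e]
  exact ⟨(d1.mul (hP 1 0).differentiableOn).add (d2.mul (hP 0 1).differentiableOn),
    (c1.mul (hP 1 0).continuous.continuousOn).add (c2.mul (hP 0 1).continuous.continuousOn)⟩

end

/-! ### Comparison of the global phase with `φ_n` -/

section

variable {σ τ : ℝ} {L : ℕ} {p : ℕ → ℝ} {q : Polynomial ℂ} {ε r R α β γ : ℝ} {a b : ℕ → ℝ}

/-- The factor `exp(i (∑_{m<N} Θ_m + ∑_{m≥N} (Θ_m - θ_m)))` relating the global ansatz to the one
with the phases `θ_m`, `m ≥ N`. -/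
noncomputable def phaseRatio (σ τ : ℝ) (L : ℕ) (p : ℕ → ℝ) (q : Polynomial ℂ) (N : ℕ) (k : ℂ) : ℂ :=
  Complex.exp (Complex.I * (∑ m ∈ Finset.range N, phase σ τ L p q m k +
    ∑' i : ℕ, (phase σ τ L p q (i + N) k - localPhase σ τ L p (i + N) k)))

theorem summable_rpow_neg_two (C : ℝ) (N : ℕ) :
    Summable fun i : ℕ => C * ((i + N : ℕ) : ℝ) ^ (-2 : ℝ) :=
  ((summable_nat_add_iff N).2 (Real.summable_nat_rpow.2 (by norm_num))).mul_left C

theorem differentiableOn_phaseRatio {N : ℕ} {C : ℝ} {U : Set ℂ} (hU : IsOpen U)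
    (hU0 : ∀ k ∈ U, k ≠ 0)
    (hs : ∀ n, N ≤ n → ∀ k ∈ U, ‖relCorrection σ τ L p n (k ^ 2)‖ ≤ 1 / 2)
    (hd : ∀ n, N ≤ n → ∀ k ∈ U,
      ‖phase σ τ L p q n k - localPhase σ τ L p n k‖ ≤ C * (n : ℝ) ^ (-2 : ℝ)) :
    DifferentiableOn ℂ (phaseRatio σ τ L p q N) U := by
  have h1 : DifferentiableOn ℂ (fun k => ∑' i : ℕ,
      (phase σ τ L p q (i + N) k - localPhase σ τ L p (i + N) k)) U :=
    Complex.differentiableOn_tsum_of_summable_norm (summable_rpow_neg_two C N)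
      (fun i k hk => ((differentiableAt_phase _ (hU0 k hk)).sub
        (differentiableAt_localPhase _ (hU0 k hk)
          (hs _ (by omega) k hk))).differentiableWithinAt) hU
      fun i k hk => hd _ (by omega) k hk
  refine DifferentiableOn.cexp (DifferentiableOn.const_mul (DifferentiableOn.add ?_ h1) _)
  exact DifferentiableOn.fun_sum fun m _ k hk =>
    (differentiableAt_phase m (hU0 k hk)).differentiableWithinAt

theorem tendsto_exp_phaseSum_div {N : ℕ} {C : ℝ} {k : ℂ} {P : CutPoint}
    (hd : ∀ n, N ≤ n → ‖phase σ τ L p q n k - localPhase σ τ L p n k‖ ≤ C * (n : ℝ) ^ (-2 : ℝ))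
    (hθ : ∀ n, N ≤ n → theta σ τ L p n P = localPhase σ τ L p n k) :
    Tendsto (fun n => Complex.exp (Complex.I * phaseSum σ τ L p q n k) /
      (phaseRatio σ τ L p q N k * Complex.exp (Complex.I * phi σ τ L p N n P))) atTop (𝓝 1) := by
  set d : ℕ → ℂ := fun i => phase σ τ L p q (i + N) k - localPhase σ τ L p (i + N) k with hd'
  have hsum : Summable d :=
    (summable_rpow_neg_two C N).of_norm_bounded fun i => hd _ (by omega)
  have ht : Tendsto (fun n => Complex.exp (Complex.I *
      (∑ i ∈ Finset.range (n + 1 - N), d i - ∑' i, d i))) atTop (𝓝 1) := by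
    have h1 := (hsum.hasSum.tendsto_sum_nat.comp ((tendsto_sub_atTop_nat N).comp
      (tendsto_add_atTop_nat 1))).sub_const (∑' i, d i)
    rw [sub_self] at h1
    have h2 := (h1.const_mul Complex.I).cexp
    rwa [mul_zero, Complex.exp_zero] at h2
  refine ht.congr' ?_
  filter_upwards [eventually_ge_atTop N] with n hn
  have hΦ : phaseSum σ τ L p q n k = ∑ m ∈ Finset.range N, phase σ τ L p q m k +
      ∑ m ∈ Finset.Ico N (n + 1), phase σ τ L p q m k :=
    (Finset.sum_range_add_sum_Ico _ (by omega)).symm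
  have hφ : phi σ τ L p N n P = ∑ m ∈ Finset.Ico N (n + 1), localPhase σ τ L p m k := by
    rw [phi, ← Finset.Ico_add_one_right_eq_Icc]
    exact Finset.sum_congr rfl fun m hm => hθ m (Finset.mem_Ico.1 hm).1
  have hD : ∑ i ∈ Finset.range (n + 1 - N), d i =
      ∑ m ∈ Finset.Ico N (n + 1), phase σ τ L p q m k -
        ∑ m ∈ Finset.Ico N (n + 1), localPhase σ τ L p m k := by
    rw [← Finset.sum_sub_distrib, Finset.sum_Ico_eq_sum_range]
    simp only [hd', add_comm N]
  rw [phaseRatio, ← Complex.exp_add, ← Complex.exp_sub, hΦ, hφ, hD]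
  congr 1
  ring

/-! ### The Jost solution on the cut plane -/

theorem firstOrder_of_asymp {c d : ℝ} {u : ℕ → ℝ} (hd : d ≠ 0)
    (h : (fun n : ℕ => u n - d * (n : ℝ) ^ σ * (1 + c * (n : ℝ)⁻¹))
      =O[atTop] fun n : ℕ => (n : ℝ) ^ (σ - 2)) :
    FirstOrder c (fun n => d⁻¹ * u n * (n : ℝ) ^ (-σ)) := by
  have h1 := (isBigO_rpow_mul h (isBigO_refl (fun n : ℕ => (n : ℝ) ^ (-σ)) atTop)
    (e := -2) (by linarith)).const_mul_left d⁻¹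
  refine h1.congr' ?_ EventuallyEq.rfl
  filter_upwards [eventually_ge_atTop 1] with n hn
  have hn0 : (0 : ℝ) < n := by exact_mod_cast hn
  have h2 : (n : ℝ) ^ σ * (n : ℝ) ^ (-σ) = 1 := by rw [← Real.rpow_add hn0]; simp
  have h3 : d⁻¹ * d = 1 := inv_mul_cancel₀ hd
  linear_combination -(d⁻¹ * d * (1 + c * (n : ℝ)⁻¹)) * h2 - (1 + c * (n : ℝ)⁻¹) * h3

theorem jost_isJacobiSolution (ha : ∀ n, 0 < a n) (hγ : |γ| = 1) {P : CutPoint}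
    (hP : P ∈ closedCutPlane γ) :
    IsJacobiSolution a b P.toComplex fun n => ((-γ : ℝ) : ℂ) ^ n *
      jost a (fun n => γ * b n) σ τ L p q n (P.scale γ).sqrt := by
  intro n hn
  obtain ⟨m, rfl⟩ : ∃ m, n = m + 1 := ⟨n - 1, by omega⟩
  have hk := (CutPoint.sqrt_sq (CutPoint.scale_mem hP)).trans (CutPoint.scale_toComplex P)
  set k := (P.scale γ).sqrt
  have hrec : a m * jost a (fun n => γ * b n) σ τ L p q m k +
      a (m + 1) * jost a (fun n => γ * b n) σ τ L p q (m + 2) k =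
      ((γ * b (m + 1) : ℝ) - k ^ 2) * jost a (fun n => γ * b n) σ τ L p q (m + 1) k :=
    recSol_rec ha _ _ m
  have hγ2 : (γ : ℂ) * γ = 1 := by
    rcases eq_or_eq_neg_one hγ with rfl | rfl <;> norm_num
  rw [hk] at hrec
  simp only [Nat.add_sub_cancel, add_assoc, one_add_one_eq_two, pow_succ]
  push_cast at hrec ⊢
  linear_combination (-γ : ℂ) ^ m * hrec + (-γ : ℂ) ^ m * a (m + 1) *
    jost a (fun n => γ * b n) σ τ L p q (m + 2) k * hγ2

theorem sqrt_mem_Ioo {P : CutPoint} (hγ : |γ| = 1) (hr : 0 < r) (hP : P ∈ closedCutPlane γ)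
    (hPa : P.toComplex ∈ annulus r R) :
    √r < ‖(P.scale γ).sqrt‖ ∧ ‖(P.scale γ).sqrt‖ < √R := by
  have h := norm_sqrt_scale_sq hγ hP
  obtain ⟨h1, h2⟩ := hPa
  rw [← h] at h1 h2
  exact ⟨(Real.sqrt_lt' (by
    refine lt_of_le_of_ne (norm_nonneg _) fun h0 => ?_
    rw [← h0] at h1
    linarith [h1.trans_eq (zero_pow two_ne_zero)])).2 h1, Real.lt_sqrt_of_sq_lt h2⟩

end

end JacobiJost

open JacobiJost in
theorem theorem2p2 (a b : ℕ → ℝ) (ha : ∀ n, 0 < a n)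
    (σ α β γ τ : ℝ) (hσ0 : 0 < σ) (hσ1 : σ < 1) (hγ : |γ| = 1)
    (hτ : τ = 2 * β - 2 * α + σ)
    (hasymp_a : (fun n : ℕ => a n - (n : ℝ) ^ σ * (1 + α * (n : ℝ)⁻¹))
      =O[atTop] fun n : ℕ => (n : ℝ) ^ (σ - 2))
    (hasymp_b : (fun n : ℕ => b n - 2 * γ * (n : ℝ) ^ σ * (1 + β * (n : ℝ)⁻¹))
      =O[atTop] fun n : ℕ => (n : ℝ) ^ (σ - 2))
    (L : ℕ) (hL : 1 < ((L : ℝ) + 1 / 2) * σ)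
    (p : ℕ → ℝ) (hp : JacobiJost.IsEikonal L p) :
    ∃ f : ℕ → JacobiJost.CutPoint → ℂ,
      (∀ P ∈ JacobiJost.closedCutPlane γ,
        JacobiJost.IsJacobiSolution a b P.toComplex fun n => f n P) ∧
      (∀ n, JacobiJost.AnalyticUpToCut γ {0}ᶜ (f n)) ∧
      ∀ r R : ℝ, 0 < r → r < R →
        ∃ N₀ : ℕ, 1 ≤ N₀ ∧ ∀ N : ℕ, N₀ ≤ N →
          (∀ m : ℕ, N ≤ m → ∀ P ∈ JacobiJost.closedCutPlane γ,
            P.toComplex ∈ JacobiJost.annulus r R →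
              JacobiJost.TPoint σ τ L p m (P.scale γ) ∈ JacobiJost.closedCutPlane 1) ∧
          ∃ c : JacobiJost.CutPoint → ℂ,
            JacobiJost.AnalyticUpToCut γ (JacobiJost.annulus r R) c ∧
            ∀ P ∈ JacobiJost.closedCutPlane γ, P.toComplex ∈ JacobiJost.annulus r R →
              c P ≠ 0 ∧
              Tendsto (fun n : ℕ => f n P / (c P * JacobiJost.ansatz γ σ τ L p N n P))
                atTop (𝓝 1) := by
  obtain ⟨ε, hε⟩ := exists_smallExponent hσ0 hσ1 hL
  -- The Taylor polynomial of the root is taken long enough to leave an error `O(n ^ (-2))`.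
  obtain ⟨K, hK⟩ : ∃ K : ℕ, 2 ≤ (K + 1) * ε := by
    obtain ⟨K, hK⟩ := exists_nat_ge (2 / ε)
    rw [div_le_iff₀ hε.pos] at hK
    exact ⟨K, by nlinarith [hε.pos]⟩
  obtain ⟨q, hq, hqK⟩ := exists_sqrt_polynomial K
  have hγ0 : γ ≠ 0 := by rintro rfl; simp at hγ
  have hA : FirstOrder α (fun n => a n * (n : ℝ) ^ (-σ)) := by
    simpa using firstOrder_of_asymp (d := 1) one_ne_zero (by simpa using hasymp_a)
  have hB : FirstOrder β (fun n => γ * b n * (n : ℝ) ^ (-σ) / 2) := by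
    have h := firstOrder_of_asymp (d := 2 * γ) (by simpa using hγ0) hasymp_b
    have hinv : (2 * γ)⁻¹ = γ / 2 := by
      rcases eq_or_eq_neg_one hγ with rfl | rfl <;> norm_num
    rw [hinv] at h
    exact h.congr' (Eventually.of_forall fun n => by ring)
  have hJ : ∀ r R, 0 < r → HasJostLimit a (fun n => γ * b n) σ τ L p q (upperAnnulus r R) :=
    fun r R hr => hasJostLimit ha hσ0 hσ1.le hr hε hp hq hK hqK hτ hA hB
  refine ⟨fun n P => ((-γ : ℝ) : ℂ) ^ n * jost a (fun n => γ * b n) σ τ L p q n (P.scale γ).sqrt,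
    fun P hP => jost_isJacobiSolution ha hγ hP, fun n => ?_, fun r R hr hrR => ?_⟩
  · obtain ⟨h1, h2⟩ := jost_analytic hJ n
    refine AnalyticUpToCut.comp_sqrt hγ (U := {0}ᶜ)
      (G := fun k => ((-γ : ℝ) : ℂ) ^ n * jost a (fun n => γ * b n) σ τ L p q n k) (by simp)
      (fun P hP _ => CutPoint.sqrt_ne_zero (CutPoint.scale_mem hP)) (h1.const_mul _)
      (continuousOn_const.mul h2)
  · have hsr : 0 < √r := Real.sqrt_pos.2 hr
    have hθ := eventually_theta_eq (σ := σ) (τ := τ) (L := L) (p := p) (R := √R)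
      hσ0 hσ1.le hsr hε
    obtain ⟨C, -, hC⟩ := unifBigO_iff.1 (unifBigO_phase_sub_localPhase (τ := τ) (p := p)
      (R := √R) hsr hσ0 hε hq hK hqK)
    obtain ⟨N₁, hN₁⟩ := eventually_atTop.1 (hθ.and hC)
    refine ⟨max 1 N₁, le_max_left _ _, fun N hN => ?_⟩
    have hNN : ∀ m, N ≤ m → N₁ ≤ m := fun m hm => ((le_max_right _ _).trans hN).trans hm
    have hann : ∀ P ∈ closedCutPlane γ, P.toComplex ∈ annulus r R →
        (P.scale γ).sqrt ∈ closedAnnulus (√r) (√R) := fun P hP hPa =>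
      ⟨(sqrt_mem_Ioo hγ hr hP hPa).1.le, (sqrt_mem_Ioo hγ hr hP hPa).2.le⟩
    refine ⟨fun m hm P hP hPa =>
      (((hN₁ m (hNN m hm)).1 _ (hann P hP hPa)).2 _ (CutPoint.scale_mem hP) rfl).1,
      fun P => phaseRatio σ τ L p q N (P.scale γ).sqrt, ?_, fun P hP hPa =>
        ⟨Complex.exp_ne_zero _, ?_⟩⟩
    · have hd : DifferentiableOn ℂ (phaseRatio σ τ L p q N) {k | √r < ‖k‖ ∧ ‖k‖ < √R} := by
        refine differentiableOn_phaseRatio (C := C) ?_ ?_ ?_ ?_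
        · exact (isOpen_lt continuous_const continuous_norm).inter
            (isOpen_lt continuous_norm continuous_const)
        · exact fun k hk => norm_pos_iff.1 (hsr.trans hk.1)
        · exact fun n hn k hk => ((hN₁ n (hNN n hn)).1 k ⟨hk.1.le, hk.2.le⟩).1
        · exact fun n hn k hk => (hN₁ n (hNN n hn)).2 k ⟨hk.1.le, hk.2.le⟩
      refine AnalyticUpToCut.comp_sqrt hγ (fun h => ?_)
        (fun P hP hPa => sqrt_mem_Ioo hγ hr hP hPa) (hd.mono Set.inter_subset_left)
        (hd.continuousOn.mono Set.inter_subset_left)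
      have h0 := h.1
      rw [norm_zero] at h0
      linarith
    · have hk := hann P hP hPa
      have hkim := CutPoint.sqrt_im_nonneg (CutPoint.scale_mem hP)
      have h1 := (hJ (√r) (√R) hsr).asymp _ ⟨hk, hkim⟩
      have h2 := tendsto_exp_phaseSum_div (σ := σ) (τ := τ) (L := L) (p := p) (q := q)
        (N := N) (C := C) (P := P.scale γ)
        (fun n hn => (hN₁ n (hNN n hn)).2 _ hk)
        (fun n hn => (((hN₁ n (hNN n hn)).1 _ hk).2 _ (CutPoint.scale_mem hP) rfl).2)
      have h3 := h1.mul h2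
      rw [one_mul] at h3
      refine h3.congr' ?_
      filter_upwards [eventually_ge_atTop 1] with n hn
      have hn0 : (0 : ℝ) < n := by exact_mod_cast hn
      have e1 : (((n : ℝ) ^ (-(σ / 4)) : ℝ) : ℂ) ≠ 0 :=
        Complex.ofReal_ne_zero.2 (Real.rpow_pos_of_pos hn0 _).ne'
      have e2 : ((-γ : ℝ) : ℂ) ^ n ≠ 0 :=
        pow_ne_zero _ (Complex.ofReal_ne_zero.2 (neg_ne_zero.2 hγ0))
      have e3 : phaseRatio σ τ L p q N (P.scale γ).sqrt ≠ 0 := Complex.exp_ne_zero _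
      have e4 := Complex.exp_ne_zero
        (Complex.I * phaseSum σ τ L p q n (P.scale γ).sqrt)
      have e5 := Complex.exp_ne_zero (Complex.I * phi σ τ L p N n (P.scale γ))
      unfold amplitude ansatz
      field_simp
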